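/- Let $\mathcal H,\mathcal E$ be complex Hilbert spaces (inner products linear in the first argument) and let $T$ be a maximal dissipative operator in $\mathcal H$, i.e. $T$ is densely defined, $\operatorname{Im}(Tf,f)\ge 0$ for all $f\in\operatorname{dom}T$, and $T$ has no proper extension in $\mathcal H$ with this property. Let $\{\mathcal E,\Gamma\}$ be a boundary pair for $T$: $\Gamma:\operatorname{dom}T\to\mathcal E$ is linear with $\overline{\operatorname{ran}}\,\Gamma=\mathcal E$ and $(Tf,g)-(f,Tg)=2i(\Gamma f,\Gamma g)_{\mathcal E}$ for all $f,g\in\operatorname{dom}T$. Notation. $\mathcal H_T^+$ is $\operatorname{dom}T$ with the inner product $(Tf,Tg)+(f,g)$, and $\mathcal H_T^-\supseteq\mathcal H$ is the space of bounded antilinear functionals on it ($h\in\mathcal H$ acts as $f\mapsto(h,f)$). $T^\times:\mathcal H\to\mathcal H_T^-$ and $\Gamma^\times:\mathcal E\to\mathcal H_T^-$ are the adjoints of the bounded operators $T:\mathcal H_T^+\to\mathcal H$ and $\Gamma:\mathcal H_T^+\to\mathcal E$. For a linear operator $S$ the Hermitian domain is $\mathcal S_S=\{f\in\operatorname{dom}S:\operatorname{Im}(Sf,f)=0\}$;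 the Hermitian part of a maximal dissipative operator $S$ is $S|_{\mathcal S_S}$; $\mathfrak N_\lambda(S)=(\operatorname{ran}(S-\bar\lambda I))^\perp$; $S$ is symmetric if $\operatorname{Im}(Sf,f)=0$ for all $f\in\operatorname{dom}S$ (the domain need not be dense); $S$ is simple if no closed subspace $\ne\{0\}$ reduces $S$ to a selfadjoint operator. We write $T\in\mathbf D_{\rm sing}$ if for every $f\in\operatorname{dom}T$ there are $f_n\in\operatorname{dom}T$ with $f_n\to f$ in $\mathcal H$ and $\operatorname{Im}(Tf_n,f_n)\to0$. For $z$ in the open upper half-plane $\mathbb C_+$ define, in $\mathcal H\oplus\mathcal E$, $$\widetilde{\mathcal T}_z=\begin{bmatrix}T&0\\2i\sqrt{\operatorname{Im}z}\,\Gamma&zI_{\mathcal E}\end{bmatrix},\quad\operatorname{dom}\widetilde{\mathcal T}_z=\operatorname{dom}T\oplus\mathcal E,$$ $$\operatorname{dom}\mathcal T_z=\left\{\begin{bmatrix}f\\-\frac{\Gamma f}{\sqrt{\operatorname{Im}z}}\end{bmatrix}:f\in\operatorname{dom}T\right\},\qquad\mathcal T_z\begin{bmatrix}f\\-\frac{\Gamma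 f}{\sqrt{\operatorname{Im}z}}\end{bmatrix}=\begin{bmatrix}Tf\\-\frac{\bar z\,\Gamma f}{\sqrt{\operatorname{Im}z}}\end{bmatrix}.$$ Then for all $z,z_1,z_2\in\mathbb C_+$: (1) $\mathcal T_z$ is symmetric and closed, and for every $\lambda\in\mathbb C$ $$\mathfrak N_\lambda(\mathcal T_z)=\left\{\begin{bmatrix}h\\y\end{bmatrix}:h\in\mathcal H,\ y\in\mathcal E,\ (T^\times-\lambda I)h=\frac{z-\lambda}{\sqrt{\operatorname{Im}z}}\Gamma^\times y\right\};$$ in particular $\mathfrak N_z(\mathcal T_z)=\{0\}\oplus\mathcal E$. (2) $\widetilde{\mathcal T}_z$ is maximal dissipative, $\operatorname{dom}\mathcal T_z$ is its Hermitian domain and $\mathcal T_z$ is its Hermitian part. (3) With $D=\begin{bmatrix}I_{\mathcal H}&0\\0&\sqrt{\operatorname{Im}z_2/\operatorname{Im}z_1}\,I_{\mathcal E}\end{bmatrix}$, $$\mathcal T_{z_2}=D\left(\mathcal T_{z_1}+\begin{bmatrix}0&0\\0&\frac{\operatorname{Im}(\bar z_2z_1)}{\operatorname{Im}z_2}I_{\mathcal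 E}\end{bmatrix}\right)D .$$ (4) $\mathcal T_z$ is densely defined if and only if $T\in\mathbf D_{\rm sing}$. The operator $T^\times-zI:\mathcal H\to\mathcal H_T^-$ is an isomorphism, and if $T\in\mathbf D_{\rm sing}$, then $$\operatorname{dom}\mathcal T_z^*=\left\{\begin{bmatrix}f+2i\sqrt{\operatorname{Im}z}\,(T^\times-zI)^{-1}\Gamma^\times y\\y+w\end{bmatrix}:f\in\operatorname{dom}T^*,\ y,w\in\mathcal E\right\},$$ $$\mathcal T_z^*\begin{bmatrix}f+2i\sqrt{\operatorname{Im}z}\,(T^\times-zI)^{-1}\Gamma^\times y\\y+w\end{bmatrix}=\begin{bmatrix}T^*f+2iz\sqrt{\operatorname{Im}z}\,(T^\times-zI)^{-1}\Gamma^\times y\\\bar z\,y+zw\end{bmatrix},$$ and $\operatorname{dom}\mathcal T_z^*$ does not depend on $z\in\mathbb C_+$. (5) $\mathcal T_z$ is simple if and only if $T$ is simple. (6) Assume $T\in\mathbf D_{\rm sing}$. Then (I) the following are equivalent: (i) $\operatorname{dom}\mathcal T_z^2=\{0\}$; (ii) $\operatorname{dom}\mathcal T_{z_1}\cap\operatorname{dom}\mathcal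 T_{z_2}=\{0\}$ for some $z_1,z_2\in\mathbb C_+$ with $\operatorname{Im}z_1\ne\operatorname{Im}z_2$; (ii′) the same for all such $z_1,z_2$; (iii) $\operatorname{dom}T\cap\operatorname{dom}T^*=\{0\}$; (II) $\mathcal S_T$ is dense in $\mathcal H$ if and only if $\operatorname{dom}\mathcal T_z^2$ is a core of $\mathcal T_z$. -/

import Mathlib

open scoped ComplexConjugate Topology

noncomputable section

/-! Notions for a single (in general unbounded) linear operator `S : H →ₗ.[ℂ] H`. In Mathlib the
inner product `inner ℂ x y` is linear in `y`, so the usual `(Sf, g)` is `inner ℂ g (S f)`. -/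

namespace LinearPMap

section Basic

variable {H : Type*} [NormedAddCommGroup H] [InnerProductSpace ℂ H]

/-- The quadratic form `γ_S[f] = Im (Sf, f)` on `dom S`. -/
def imForm (S : H →ₗ.[ℂ] H) (f : S.domain) : ℝ := (inner ℂ (f : H) (S f)).im

/-- `S` is symmetric (its domain need not be dense): `Im (Sf, f) = 0` on `dom S`. -/
def IsSymm (S : H →ₗ.[ℂ] H) : Prop := ∀ f : S.domain, S.imForm f = 0

/-- `S` is dissipative: `Im (Sf, f) ≥ 0` on `dom S`. -/
def IsDissipative (S : H →ₗ.[ℂ] H) : Prop := ∀ f : S.domain, 0 ≤ S.imForm f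

/-- `S` is maximal dissipative: densely defined, dissipative, and without proper dissipative
extensions in the same space. -/
structure IsMaxDissipative (S : H →ₗ.[ℂ] H) : Prop where
  dense : Dense (S.domain : Set H)
  dissipative : S.IsDissipative
  maximal : ∀ S' : H →ₗ.[ℂ] H, S'.IsDissipative → S ≤ S' → S' = S

/-- The Hermitian domain `{f ∈ dom S : Im (Sf, f) = 0}` of `S`. -/
def hermDomain (S : H →ₗ.[ℂ] H) : Set H := {f | ∃ hf : f ∈ S.domain, S.imForm ⟨f, hf⟩ = 0}

/-- `A` is the Hermitian part of the maximal dissipative operator `S`: the restriction of `S` to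
its Hermitian domain. -/
structure IsHermitianPart (A S : H →ₗ.[ℂ] H) : Prop where
  domain_eq : (A.domain : Set H) = S.hermDomain
  le : A ≤ S

/-- The form `γ_S` is singular: every `f ∈ dom S` is the limit in `H` of a sequence `u n ∈ dom S`
with `γ_S[u n] → 0`. -/
def SingularForm (S : H →ₗ.[ℂ] H) : Prop :=
  ∀ f : S.domain, ∃ u : ℕ → S.domain,
    Filter.Tendsto (fun n => (u n : H)) Filter.atTop (𝓝 (f : H)) ∧
    Filter.Tendsto (fun n => S.imForm (u n)) Filter.atTop (𝓝 0)

/-- The class of maximal dissipative operators whose form `γ_S` is singular. -/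
def IsDSing (S : H →ₗ.[ℂ] H) : Prop := S.IsMaxDissipative ∧ S.SingularForm

/-- The linear manifold `ran (S - μ I)`. -/
def shiftRange (S : H →ₗ.[ℂ] H) (μ : ℂ) : Submodule ℂ H :=
  LinearMap.range (S.toFun - μ • S.domain.subtype)

/-- The deficiency subspace of `S` at `μ`: the orthogonal complement of `ran (S - conj μ I)`. -/
def deficiencySpace (S : H →ₗ.[ℂ] H) (μ : ℂ) : Submodule ℂ H := (S.shiftRange (conj μ))ᗮ

/-- The domain `{f ∈ dom S : S f ∈ dom S}` of the square of `S`. -/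
def sqDomain (S : H →ₗ.[ℂ] H) : Submodule ℂ H :=
  (S.domain.comap S.toFun).map S.domain.subtype

/-- The product `S D` of `S` with an everywhere defined operator `D`, on its natural domain
`{x : D x ∈ dom S}`. -/
def compEverywhere (S : H →ₗ.[ℂ] H) (D : H →ₗ[ℂ] H) : H →ₗ.[ℂ] H where
  domain := S.domain.comap D
  toFun := S.toFun ∘ₗ D.restrict (fun _ hx => hx)

/-- The closed subspace `K` reduces `S`: the orthogonal projection onto `K` maps `dom S` into
itself, and `S` maps `dom S ∩ K` into `K` and `dom S ∩ Kᗮ` into `Kᗮ`. -/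
structure Reduces (S : H →ₗ.[ℂ] H) (K : Submodule ℂ H) [K.HasOrthogonalProjection] : Prop where
  proj_mem : ∀ x ∈ S.domain, K.starProjection x ∈ S.domain
  map_mem : ∀ x : S.domain, (x : H) ∈ K → S x ∈ K
  map_mem_orthogonal : ∀ x : S.domain, (x : H) ∈ Kᗮ → S x ∈ Kᗮ

/-- The part of `S` in a subspace `K` with `S (dom S ∩ K) ⊆ K`: the operator in `K` with domain
`dom S ∩ K` acting as `S`. -/
def part (S : H →ₗ.[ℂ] H) (K : Submodule ℂ H) (hK : ∀ x : S.domain, (x : H) ∈ K → S x ∈ K) :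
    K →ₗ.[ℂ] K where
  domain := S.domain.comap K.subtype
  toFun := LinearMap.codRestrict K
    (S.toFun ∘ₗ K.subtype.restrict (p := S.domain.comap K.subtype) (q := S.domain)
      (fun _ hx => hx)) (fun x => hK ⟨_, x.2⟩ x.1.2)

/-- `S` is simple: no nontrivial closed subspace `K` reduces `S` in such a way that the part of
`S` in `K` is selfadjoint. (In a Hilbert space `K` is closed iff it is complete.) -/
def IsSimple (S : H →ₗ.[ℂ] H) : Prop :=
  ∀ (K : Submodule ℂ H) [CompleteSpace K] (hK : S.Reduces K),
    IsSelfAdjoint (S.part K hK.map_mem) → K = ⊥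

end Basic

end LinearPMap

/-! The rigged Hilbert space `H_T^+ ⊆ H ⊆ H_T^-` of an operator `T`. -/

section Rigged

variable {H : Type*} [NormedAddCommGroup H] [InnerProductSpace ℂ H]

/-- `H_T^+`: the linear manifold `dom T` with the inner product `(Tf, Tg) + (f, g)`. -/
def HPlus (T : H →ₗ.[ℂ] H) : Type _ := T.domain

namespace HPlus

variable (T : H →ₗ.[ℂ] H)

instance : AddCommGroup (HPlus T) := inferInstanceAs (AddCommGroup T.domain)

instance : Module ℂ (HPlus T) := inferInstanceAs (Module ℂ T.domain)

/-- The identity map from `H_T^+` to `dom T`. -/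
def toDomain : HPlus T ≃ₗ[ℂ] T.domain := LinearEquiv.refl ℂ T.domain

/-- The inner product of `H_T^+`. -/
@[reducible] def core : InnerProductSpace.Core ℂ (HPlus T) where
  inner f g := inner ℂ (T (toDomain T f)) (T (toDomain T g)) +
    inner ℂ (toDomain T f : H) (toDomain T g : H)
  conj_inner_symm f g := by simp [inner_conj_symm]
  re_inner_nonneg f := by
    have h1 : 0 ≤ (inner ℂ (T (toDomain T f)) (T (toDomain T f))).re :=
      inner_self_nonneg (𝕜 := ℂ)
    have h2 : 0 ≤ (inner ℂ (toDomain T f : H) (toDomain T f : H)).re :=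
      inner_self_nonneg (𝕜 := ℂ)
    simpa using add_nonneg h1 h2
  add_left f g h := by
    simp only [map_add, LinearPMap.map_add, Submodule.coe_add, inner_add_left]; ring
  smul_left f g r := by
    simp only [map_smul, LinearPMap.map_smul, Submodule.coe_smul, inner_smul_left]; ring
  definite f hf := by
    have h1 : 0 ≤ (inner ℂ (T (toDomain T f)) (T (toDomain T f))).re :=
      inner_self_nonneg (𝕜 := ℂ)
    have h2 : 0 ≤ (inner ℂ (toDomain T f : H) (toDomain T f : H)).re :=
      inner_self_nonneg (𝕜 := ℂ)
    have h3 := congrArg Complex.re hf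
    simp only [Complex.add_re, Complex.zero_re] at h3
    have h4 : (inner ℂ (toDomain T f : H) (toDomain T f : H)).re = 0 := by linarith
    have h5 : (toDomain T f : H) = 0 :=
      (inner_self_eq_zero (𝕜 := ℂ)).1 (Complex.ext h4 (inner_self_im (𝕜 := ℂ) _))
    exact (LinearEquiv.map_eq_zero_iff (toDomain T)).1 (Subtype.ext h5)

instance : NormedAddCommGroup (HPlus T) := (core T).toNormedAddCommGroup

instance : InnerProductSpace ℂ (HPlus T) := InnerProductSpace.ofCore (core T).toCore

theorem inner_def (f g : HPlus T) :
    inner ℂ f g = inner ℂ (T (toDomain T f)) (T (toDomain T g)) +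
      inner ℂ (toDomain T f : H) (toDomain T g : H) := rfl

theorem norm_sq (f : HPlus T) :
    ‖f‖ ^ 2 = ‖T (toDomain T f)‖ ^ 2 + ‖(toDomain T f : H)‖ ^ 2 := by
  have h := congrArg Complex.re (inner_def T f f)
  rw [inner_self_eq_norm_sq_to_K, inner_self_eq_norm_sq_to_K, inner_self_eq_norm_sq_to_K] at h
  exact_mod_cast h

theorem norm_apply_le (f : HPlus T) : ‖T (toDomain T f)‖ ≤ ‖f‖ :=
  abs_le_of_sq_le_sq' (by rw [norm_sq]; nlinarith [sq_nonneg ‖(toDomain T f : H)‖])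
    (norm_nonneg _) |>.2

theorem norm_coe_le (f : HPlus T) : ‖(toDomain T f : H)‖ ≤ ‖f‖ :=
  abs_le_of_sq_le_sq' (by rw [norm_sq]; nlinarith [sq_nonneg ‖T (toDomain T f)‖])
    (norm_nonneg _) |>.2

/-- The embedding of `H_T^+` into `H`. -/
def incl : HPlus T →L[ℂ] H :=
  (T.domain.subtype ∘ₗ (toDomain T).toLinearMap).mkContinuous 1
    (fun f => by simpa using norm_coe_le T f)

/-- `T` as a bounded operator from `H_T^+` to `H`. -/
def opPlus : HPlus T →L[ℂ] H :=
  (T.toFun ∘ₗ (toDomain T).toLinearMap).mkContinuous 1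
    (fun f => by simpa using norm_apply_le T f)

end HPlus

/-- `H_T^-`: the bounded antilinear functionals on `H_T^+`. -/
abbrev HMinus (T : H →ₗ.[ℂ] H) : Type _ := HPlus T →L⋆[ℂ] ℂ

/-- The adjoint `A^× : G → H_T^-` of a bounded operator `A : H_T^+ → G` into a Hilbert space `G`:
the functional `A^× e` is `f ↦ ⟪A f, e⟫`. -/
def riggedAdjoint (T : H →ₗ.[ℂ] H) {G : Type*} [NormedAddCommGroup G] [InnerProductSpace ℂ G]
    (A : HPlus T →L[ℂ] G) : G →L[ℂ] HMinus T :=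
  ((innerSL ℂ).comp A).flip

theorem riggedAdjoint_apply (T : H →ₗ.[ℂ] H) {G : Type*} [NormedAddCommGroup G]
    [InnerProductSpace ℂ G] (A : HPlus T →L[ℂ] G) (e : G) (f : HPlus T) :
    riggedAdjoint T A e f = inner ℂ (A f) e := rfl

/-- The embedding of `H` into `H_T^-`: `h` is the functional `f ↦ ⟪f, h⟫`. -/
def inclMinus (T : H →ₗ.[ℂ] H) : H →L[ℂ] HMinus T := riggedAdjoint T (HPlus.incl T)

/-- `T^× : H → H_T^-`, the adjoint of `T : H_T^+ → H`. -/
def opCross (T : H →ₗ.[ℂ] H) : H →L[ℂ] HMinus T := riggedAdjoint T (HPlus.opPlus T)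

/-- `T^× - μ I`, as an operator from `H` to `H_T^-`. -/
def opCrossSub (T : H →ₗ.[ℂ] H) (μ : ℂ) : H →L[ℂ] HMinus T := opCross T - μ • inclMinus T

/-- A boundary pair `{E, Γ}` of `T`: a linear map `Γ : dom T → E` with dense range that satisfies
the Green identity `(Tf, g) - (f, Tg) = 2i (Γf, Γg)`. -/
structure BoundaryPair (T : H →ₗ.[ℂ] H) (E : Type*) [NormedAddCommGroup E]
    [InnerProductSpace ℂ E] where
  Γ : T.domain →ₗ[ℂ] E
  denseRange : DenseRange Γ
  green : ∀ f g : T.domain,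
    inner ℂ (g : H) (T f) - inner ℂ (T g) (f : H) = 2 * Complex.I * inner ℂ (Γ g) (Γ f)

namespace BoundaryPair

variable {T : H →ₗ.[ℂ] H} {E : Type*} [NormedAddCommGroup E] [InnerProductSpace ℂ E]

theorem norm_sq_eq (P : BoundaryPair T E) (f : T.domain) :
    ‖P.Γ f‖ ^ 2 = (inner ℂ (f : H) (T f)).im := by
  have h := congrArg Complex.im (P.green f f)
  rw [inner_self_eq_norm_sq_to_K, ← inner_conj_symm (T f) (f : H)] at h
  simp only [Complex.sub_im, Complex.conj_im, Complex.coe_algebraMap, ← Complex.ofReal_pow,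
    Complex.mul_im, Complex.mul_re, Complex.ofReal_re, Complex.ofReal_im, Complex.I_re,
    Complex.I_im, Complex.re_ofNat, Complex.im_ofNat] at h
  linarith

theorem norm_le (P : BoundaryPair T E) (f : HPlus T) : ‖P.Γ (HPlus.toDomain T f)‖ ≤ ‖f‖ := by
  have h1 := P.norm_sq_eq (HPlus.toDomain T f)
  have h2 := (Complex.abs_im_le_norm _).trans
    (norm_inner_le_norm (𝕜 := ℂ) (HPlus.toDomain T f : H) (T (HPlus.toDomain T f)))
  have h3 := le_abs_self (inner ℂ (HPlus.toDomain T f : H) (T (HPlus.toDomain T f))).im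
  have h4 := mul_le_mul (HPlus.norm_coe_le T f) (HPlus.norm_apply_le T f) (norm_nonneg _)
    (norm_nonneg _)
  exact (abs_le_of_sq_le_sq' (by nlinarith) (norm_nonneg _)).2

/-- `Γ` as a bounded operator from `H_T^+` to `E`. -/
def gammaPlus (P : BoundaryPair T E) : HPlus T →L[ℂ] E :=
  (P.Γ ∘ₗ (HPlus.toDomain T).toLinearMap).mkContinuous 1 (fun f => by simpa using P.norm_le f)

/-- `Γ^× : E → H_T^-`, the adjoint of `Γ : H_T^+ → E`. -/
def gammaCross (P : BoundaryPair T E) : E →L[ℂ] HMinus T := riggedAdjoint T P.gammaPlus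

/-- The operator `(T^× - z I)⁻¹ Γ^× : E → H`. It is meaningful when `T^× - z I : H → H_T^-` is an
isomorphism. -/
def crossResolventGamma (P : BoundaryPair T E) (z : ℂ) : E →L[ℂ] H :=
  (opCrossSub T z).inverse.comp P.gammaCross

end BoundaryPair

end Rigged

/-! Operators in the orthogonal sum `H ⊕ E`. -/

section Lift

variable {H : Type*} [NormedAddCommGroup H] [InnerProductSpace ℂ H]
  {E : Type*} [NormedAddCommGroup E] [InnerProductSpace ℂ E]

/-- The vector with components `h` and `e` in the Hilbert space `H ⊕ E`. -/
def hsum (h : H) (e : E) : WithLp 2 (H × E) := WithLp.toLp 2 (h, e)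

/-- The block operator `diag (a I_H, b I_E)` in `H ⊕ E`. -/
def blockDiag (H E : Type*) [NormedAddCommGroup H] [InnerProductSpace ℂ H]
    [NormedAddCommGroup E] [InnerProductSpace ℂ E] (a b : ℂ) :
    WithLp 2 (H × E) →ₗ[ℂ] WithLp 2 (H × E) where
  toFun x := hsum (a • x.fst) (b • x.snd)
  map_add' x y := by
    apply WithLp.ofLp_injective; ext <;> simp [hsum]
  map_smul' c x := by
    apply WithLp.ofLp_injective; ext <;> simp [hsum, smul_comm c]

namespace BoundaryPair

variable {T : H →ₗ.[ℂ] H} (P : BoundaryPair T E)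

/-- The lifting of `T` to `H ⊕ E`, with domain `dom T ⊕ E`, acting as
`f ⊕ e ↦ Tf ⊕ (2i √(Im z) Γf + z e)`. -/
def lift (z : ℂ) : WithLp 2 (H × E) →ₗ.[ℂ] WithLp 2 (H × E) where
  domain := T.domain.comap (WithLp.fstₗ 2 ℂ H E)
  toFun :=
    { toFun := fun x => hsum (T ⟨x.1.fst, x.2⟩)
        ((2 * Complex.I * (Real.sqrt z.im : ℂ)) • P.Γ ⟨x.1.fst, x.2⟩ + z • x.1.snd)
      map_add' := fun x y => by
        have h : (⟨(x + y).1.fst, (x + y).2⟩ : T.domain) = ⟨x.1.fst, x.2⟩ + ⟨y.1.fst, y.2⟩ := rfl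
        rw [h, LinearPMap.map_add, map_add]
        apply WithLp.ofLp_injective
        ext
        · simp [hsum]
        · simp only [hsum, smul_add, Submodule.coe_add, WithLp.add_snd, WithLp.ofLp_add,
            Prod.snd_add]
          abel
      map_smul' := fun c x => by
        have h : (⟨(c • x).1.fst, (c • x).2⟩ : T.domain) = c • ⟨x.1.fst, x.2⟩ := rfl
        rw [h, LinearPMap.map_smul, map_smul]
        apply WithLp.ofLp_injective
        ext
        · simp [hsum]
        · simp [hsum, smul_comm c] }

/-- The map `f ↦ f ⊕ (-Γf / √(Im z))` from `dom T` to `H ⊕ E`. -/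
def graphEmb (z : ℂ) : T.domain →ₗ[ℂ] WithLp 2 (H × E) where
  toFun f := hsum (f : H) (-(1 / (Real.sqrt z.im : ℂ)) • P.Γ f)
  map_add' f g := by
    apply WithLp.ofLp_injective; ext <;> simp [hsum]
  map_smul' c f := by
    apply WithLp.ofLp_injective; ext <;> simp [hsum, smul_comm c]

/-- The map `f ↦ Tf ⊕ (-conj z Γf / √(Im z))` from `dom T` to `H ⊕ E`. -/
def graphVal (z : ℂ) : T.domain →ₗ[ℂ] WithLp 2 (H × E) where
  toFun f := hsum (T f) (-(conj z / (Real.sqrt z.im : ℂ)) • P.Γ f)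
  map_add' f g := by
    apply WithLp.ofLp_injective; ext <;> simp [hsum, LinearPMap.map_add]
  map_smul' c f := by
    apply WithLp.ofLp_injective; ext <;> simp [hsum, smul_comm c, LinearPMap.map_smul]

theorem graphEmb_injective (z : ℂ) : Function.Injective (P.graphEmb z) := fun _ _ h =>
  Subtype.ext (congrArg WithLp.fst h)

/-- The operator in `H ⊕ E` that maps `f ⊕ (-Γf / √(Im z))` to `Tf ⊕ (-conj z Γf / √(Im z))`,
`f ∈ dom T`. -/
def symOp (z : ℂ) : WithLp 2 (H × E) →ₗ.[ℂ] WithLp 2 (H × E) where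
  domain := LinearMap.range (P.graphEmb z)
  toFun := P.graphVal z ∘ₗ
    (LinearEquiv.ofInjective (P.graphEmb z) (P.graphEmb_injective z)).symm.toLinearMap

theorem symOp_apply (z : ℂ) (f : T.domain) :
    P.symOp z ⟨P.graphEmb z f, LinearMap.mem_range_self _ f⟩ = P.graphVal z f := by
  change P.graphVal z ((LinearEquiv.ofInjective (P.graphEmb z) (P.graphEmb_injective z)).symm
    ((LinearEquiv.ofInjective (P.graphEmb z) (P.graphEmb_injective z)) f)) = _
  rw [LinearEquiv.symm_apply_apply]

end BoundaryPair

end Lift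

end

/-!
Everything rests on two facts. For `Im μ < 0` the operator `T - μ` maps `H_T^+` isomorphically
onto `H` (`LinearPMap.IsMaxDissipative.exists_sub_smul_eq`, `HPlus.exists_resolvent`); by duality
`T^× - z` is an isomorphism for `Im z > 0` (`isInvertible_opCrossSub`). And the form of the lifting
is `‖Γ f + √(Im z) e‖²` (`BoundaryPair.imForm_lift`), which vanishes exactly on the vectors
`f ⊕ (-Γ f / √(Im z))`. So the lifting is dissipative, maximal by back substitution, and has `T_z`
as its Hermitian part; the graph of `T_z` is the closed graph of the lifting intersected with the
closed condition `Im ⟪x, y⟫ = 0`.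

The deficiency subspaces and the adjoint of `T_z` come from the single identity
`BoundaryPair.inner_graphVal_sub_inner_graphEmb`, and density of `dom T_z` is density of the graph
of `Γ`. The factor `z - conj z = 2i Im z` turns the adjoint condition into membership in `dom T*`
after subtracting `2i √(Im z) (T^× - z)⁻¹ Γ^× y`.

For simplicity, let `K` reduce `T_z` to a selfadjoint operator. The projection onto `K` of a vector
`0 ⊕ e` of the deficiency subspace at `z` is an eigenvector of that operator with eigenvalue `z`,
hence zero (`BoundaryPair.snd_eq_zero_of_isSelfAdjoint_part`). Thus `K = L ⊕ 0`, `Γ` vanishes on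
`dom T ∩ L`, and the parts of `T_z` in `K` and of `T` in `L` are the same operator.

For the square, `(T_z - conj z) (f ⊕ (-Γ f / √(Im z))) = (T - conj z) f ⊕ 0`, and the vector is in
`dom T_z²` iff `(T - conj z) f` is in `ker Γ`, the Hermitian domain of `T`
(`BoundaryPair.mem_sqDomain_symOp_iff`). As `T - conj z` is a bijection onto `H`, triviality of
`dom T_z²` and its being a core are triviality and density of `ker Γ`. If the form is singular,
`ker Γ = dom T ∩ dom T*` (`BoundaryPair.mem_domain_inf_adjoint_domain_iff`).
-/

/-! ### Maximal dissipative operators -/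

namespace LinearPMap

variable {H : Type*} [NormedAddCommGroup H] [InnerProductSpace ℂ H] {S : H →ₗ.[ℂ] H}

theorem imForm_nonneg_of_mem_graph (hS : S.IsDissipative) {x y : H} (h : (x, y) ∈ S.graph) :
    0 ≤ (inner ℂ x y).im := by
  obtain ⟨u, rfl, rfl⟩ := (S.mem_graph_iff).1 h
  exact hS u

/-- If `a + Im (c w) ≥ 0` for every complex `c`, then `w = 0`. -/
theorem eq_zero_of_forall_add_im_mul_nonneg {a : ℝ} {w : ℂ}
    (h : ∀ c : ℂ, 0 ≤ a + (c * w).im) : w = 0 := by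
  by_contra hw
  have h1 := h (-((a + 1 : ℝ) : ℂ) * Complex.I / w)
  rw [div_mul_cancel₀ _ hw] at h1
  simp at h1
  linarith

/-- A pair that can be adjoined to the graph of a maximal dissipative operator without losing
dissipativity already belongs to the graph. -/
theorem IsMaxDissipative.mem_graph (hS : S.IsMaxDissipative) {f g : H}
    (h : ∀ (u : S.domain) (c : ℂ), 0 ≤ (inner ℂ ((u : H) + c • f) (S u + c • g)).im) :
    (f, g) ∈ S.graph := by
  have hf : f ∈ S.domain := by
    by_contra hf
    have hd : (S.supSpanSingleton f g hf).IsDissipative := by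
      rintro ⟨x, hx⟩
      obtain ⟨u, hu, v, hv, rfl⟩ := Submodule.mem_sup.1 hx
      obtain ⟨c, rfl⟩ := Submodule.mem_span_singleton.1 hv
      change 0 ≤ (inner ℂ (u + c • f) (S.supSpanSingleton f g hf ⟨u + c • f, hx⟩)).im
      rw [supSpanSingleton_apply_mk S f g hf u hu c]
      exact h ⟨u, hu⟩ c
    have := hS.maximal _ hd (LinearPMap.left_le_sup _ _ _)
    apply hf
    rw [← this, domain_supSpanSingleton]
    exact Submodule.mem_sup_right (Submodule.mem_span_singleton_self f)
  -- replacing `u` by `v - c f` turns the hypothesis into an affine inequality in `c`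
  have key : ∀ v : S.domain, inner ℂ (v : H) (g - S ⟨f, hf⟩) = 0 := fun v =>
    eq_zero_of_forall_add_im_mul_nonneg (a := S.imForm v) fun c => by
      have := h (v - c • ⟨f, hf⟩) c
      rw [LinearPMap.map_sub, LinearPMap.map_smul] at this
      simp only [AddSubgroupClass.coe_sub, Submodule.coe_smul, sub_add_cancel] at this
      rw [show S v - c • S ⟨f, hf⟩ + c • g = S v + c • (g - S ⟨f, hf⟩) by module,
        inner_add_right, inner_smul_right] at this
      exact this
  have h0 : g - S ⟨f, hf⟩ = 0 := hS.dense.eq_zero_of_inner_right ℂ fun v hv => key ⟨v, hv⟩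
  rw [sub_eq_zero.1 h0]
  exact S.mem_graph ⟨f, hf⟩

/-- A maximal dissipative operator is closed, because limits of graph points can be adjoined to
the graph without losing dissipativity. -/
theorem IsMaxDissipative.isClosed (hS : S.IsMaxDissipative) : S.IsClosed := by
  refine isClosed_of_closure_subset fun p hp => ?_
  refine hS.mem_graph (f := p.1) (g := p.2) fun u c => ?_
  have hcl : _root_.IsClosed {q : H × H | 0 ≤ (inner ℂ ((u : H) + c • q.1) (S u + c • q.2)).im} :=
    isClosed_le continuous_const (by fun_prop)
  refine hcl.closure_subset_iff.2 ?_ hp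
  rintro ⟨x, y⟩ hxy
  refine imForm_nonneg_of_mem_graph hS.dissipative ?_
  exact S.graph.add_mem (S.mem_graph u) (S.graph.smul_mem c hxy)

/-- For dissipative `S` and `μ` in the lower half-plane this bounds `S - μ` from below. -/
theorem IsDissipative.norm_le (hS : S.IsDissipative) (μ : ℂ) (f : S.domain) :
    -μ.im * ‖(f : H)‖ ≤ ‖S f - μ • (f : H)‖ := by
  have h1 : -μ.im * ‖(f : H)‖ ^ 2 ≤ (inner ℂ (f : H) (S f - μ • (f : H))).im := by
    have := hS f
    have h0 : inner ℂ (f : H) (f : H) = ((‖(f : H)‖ ^ 2 : ℝ) : ℂ) := by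
      rw [inner_self_eq_norm_sq_to_K]
      norm_cast
    rw [inner_sub_right, inner_smul_right, h0, Complex.sub_im, Complex.im_mul_ofReal]
    unfold imForm at this
    linarith
  have h2 := (Complex.abs_im_le_norm _).trans
    (norm_inner_le_norm (𝕜 := ℂ) (f : H) (S f - μ • (f : H)))
  have h3 := (le_abs_self _).trans h2
  rcases eq_or_ne ‖(f : H)‖ 0 with h | h
  · simp [h]
  · have : 0 < ‖(f : H)‖ := lt_of_le_of_ne (norm_nonneg _) h.symm
    refine le_of_mul_le_mul_left ?_ this
    nlinarith

theorem IsDissipative.eq_of_sub_smul_eq (hS : S.IsDissipative) {μ : ℂ} (hμ : μ.im < 0)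
    {f g : S.domain} (h : S f - μ • (f : H) = S g - μ • (g : H)) : f = g := by
  have h1 := hS.norm_le μ (f - g)
  have h2 : S (f - g) - μ • ((f - g : S.domain) : H) = 0 := by
    rw [LinearPMap.map_sub, Submodule.coe_sub, smul_sub]
    rw [← sub_eq_zero] at h
    rw [← h]
    abel
  rw [h2, norm_zero] at h1
  have h3 : ‖((f - g : S.domain) : H)‖ = 0 := by
    nlinarith [norm_nonneg ((f - g : S.domain) : H)]
  exact sub_eq_zero.1 (Subtype.ext (norm_eq_zero.1 h3))

/-- For maximal dissipative `S`, the operator `S - μ` is onto for `μ` in the lower half-plane. The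
range is closed. If `n` is orthogonal to it, then the pair `(n, conj μ n)` can be adjoined to the
graph of `S`, so `S n = conj μ n`, and `⟪n, (S - μ) n⟫ = 0` forces `n = 0`. -/
theorem IsMaxDissipative.exists_sub_smul_eq [CompleteSpace H] (hS : S.IsMaxDissipative) {μ : ℂ}
    (hμ : μ.im < 0) (h : H) : ∃ f : S.domain, S f - μ • (f : H) = h := by
  have hclosed : _root_.IsClosed (S.shiftRange μ : Set H) := by
    refine IsSeqClosed.isClosed fun {v y} hv hy => ?_
    choose f hf using fun n => LinearMap.mem_range.1 (hv n)
    have hf' : ∀ n, S (f n) - μ • (f n : H) = v n := hf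
    have hcs : CauchySeq fun n => (f n : H) := by
      have hc : CauchySeq fun n => (-μ.im)⁻¹ • v n :=
        (hy.const_smul _).cauchySeq
      rw [Metric.cauchySeq_iff] at hc ⊢
      intro ε hε
      obtain ⟨N, hN⟩ := hc ε hε
      refine ⟨N, fun m hm n hn => lt_of_le_of_lt ?_ (hN m hm n hn)⟩
      rw [dist_eq_norm, dist_eq_norm, ← smul_sub, norm_smul, Real.norm_eq_abs,
        abs_of_pos (inv_pos.2 (by linarith)), ← hf' m, ← hf' n, le_inv_mul_iff₀ (by linarith)]
      have := hS.dissipative.norm_le μ (f m - f n)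
      rw [LinearPMap.map_sub, Submodule.coe_sub] at this
      refine this.trans_eq ?_
      congr 1
      module
    obtain ⟨x, hx⟩ := cauchySeq_tendsto_of_complete hcs
    have hSf : Filter.Tendsto (fun n => S (f n)) Filter.atTop (𝓝 (y + μ • x)) := by
      have : (fun n => S (f n)) = fun n => v n + μ • (f n : H) := by
        funext n
        rw [← hf' n]
        abel
      rw [this]
      exact hy.add (hx.const_smul μ)
    have hmem : (x, y + μ • x) ∈ S.graph :=
      hS.isClosed.mem_of_tendsto (hx.prodMk_nhds hSf)
        (Filter.Eventually.of_forall fun n => S.mem_graph (f n))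
    obtain ⟨u, hu, hSu⟩ := (S.mem_graph_iff).1 hmem
    refine LinearMap.mem_range.2 ⟨u, ?_⟩
    change S u - μ • (u : H) = y
    simp only at hu hSu
    rw [hSu, hu]
    abel
  have horth : (S.shiftRange μ)ᗮ = ⊥ := by
    refine (Submodule.eq_bot_iff _).2 fun n hn => ?_
    have hn' : ∀ u : S.domain, inner ℂ n (S u) = μ * inner ℂ n (u : H) := fun u => by
      have := Submodule.inner_left_of_mem_orthogonal (K := S.shiftRange μ)
        (LinearMap.mem_range_self _ u) hn
      change inner ℂ n (S u - μ • (u : H)) = 0 at this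
      rwa [inner_sub_right, inner_smul_right, sub_eq_zero] at this
    have hmem : (n, conj μ • n) ∈ S.graph := hS.mem_graph fun u c => by
      have h1 := hS.dissipative u
      unfold imForm at h1
      have h2 : inner ℂ ((u : H) + c • n) (S u + c • conj μ • n) =
          inner ℂ (u : H) (S u) + (conj μ * (c * inner ℂ (u : H) n) +
            conj (conj μ * (c * inner ℂ (u : H) n))) +
            conj μ * ((‖c‖ ^ 2 * ‖n‖ ^ 2 : ℝ) : ℂ) := by
        simp only [inner_add_left, inner_add_right, inner_smul_left, inner_smul_right, hn',
          inner_self_eq_norm_sq_to_K, map_mul, inner_conj_symm, Complex.conj_conj,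
          Complex.ofReal_mul, Complex.ofReal_pow, ← Complex.conj_mul', Complex.coe_algebraMap]
        ring
      rw [h2, Complex.add_conj, Complex.add_im, Complex.add_im, Complex.ofReal_im,
        Complex.im_mul_ofReal, Complex.conj_im]
      have : 0 ≤ ‖c‖ ^ 2 * ‖n‖ ^ 2 := by positivity
      nlinarith
    obtain ⟨u, hu, hSu⟩ := (S.mem_graph_iff).1 hmem
    simp only at hu hSu
    have h1 := hn' u
    rw [hSu, hu, inner_smul_right, ← sub_eq_zero, ← sub_mul] at h1
    rcases mul_eq_zero.1 h1 with h2 | h2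
    · have := congrArg Complex.im h2
      simp at this
      exact absurd this (by linarith)
    · exact inner_self_eq_zero.1 h2
  have htop : S.shiftRange μ = ⊤ := by
    have : CompleteSpace (S.shiftRange μ) := hclosed.completeSpace_coe
    exact (Submodule.orthogonal_eq_bot_iff).1 horth
  obtain ⟨f, hf⟩ := LinearMap.mem_range.1 (htop ▸ Submodule.mem_top : h ∈ S.shiftRange μ)
  exact ⟨f, hf⟩

/-- A densely defined dissipative operator `S` with `S - μ` onto for some `μ` in the lower
half-plane is maximal: `S' - μ` is injective for each dissipative `S'`. -/
theorem IsDissipative.isMaxDissipative (hS : S.IsDissipative) (hd : Dense (S.domain : Set H))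
    {μ : ℂ} (hμ : μ.im < 0) (hsurj : ∀ h : H, ∃ f : S.domain, S f - μ • (f : H) = h) :
    S.IsMaxDissipative where
  dense := hd
  dissipative := hS
  maximal S' hS' hle := by
    refine (eq_of_le_of_domain_eq hle (le_antisymm hle.1 fun x hx => ?_)).symm
    obtain ⟨f, hf⟩ := hsurj (S' ⟨x, hx⟩ - μ • x)
    have h1 : S f = S' ⟨f, hle.1 f.2⟩ := hle.2 rfl
    have h2 := hS'.eq_of_sub_smul_eq hμ (f := ⟨f, hle.1 f.2⟩) (g := ⟨x, hx⟩) (by rw [← h1, hf])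
    have h3 : (f : H) = x := congrArg Subtype.val h2
    exact h3 ▸ f.2

end LinearPMap

namespace HPlus

variable {H : Type*} [NormedAddCommGroup H] [InnerProductSpace ℂ H] {T : H →ₗ.[ℂ] H}

/-- The resolvent `(T - μ)⁻¹` at a point `μ` of the lower half-plane, as an operator into
`H_T^+`. -/
theorem exists_resolvent [CompleteSpace H] (hT : T.IsMaxDissipative) {μ : ℂ} (hμ : μ.im < 0) :
    ∃ R : H →L[ℂ] HPlus T, (∀ h, opPlus T (R h) - μ • incl T (R h) = h) ∧
      ∀ f, R (opPlus T f - μ • incl T f) = f := by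
  let A : HPlus T →ₗ[ℂ] H := (opPlus T - μ • incl T : HPlus T →L[ℂ] H)
  have hA : ∀ f, A f = T (toDomain T f) - μ • (toDomain T f : H) := fun f => rfl
  have hbij : Function.Bijective A := by
    constructor
    · intro f g hfg
      rw [hA, hA] at hfg
      exact (toDomain T).injective (hT.dissipative.eq_of_sub_smul_eq hμ hfg)
    · intro h
      obtain ⟨f, hf⟩ := hT.exists_sub_smul_eq hμ h
      exact ⟨(toDomain T).symm f, hf⟩
  let e := LinearEquiv.ofBijective A hbij
  have he : ∀ h, A (e.symm h) = h := fun h => e.apply_symm_apply h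
  have hbound : ∀ h, ‖e.symm h‖ ≤ ((-μ.im)⁻¹ + (1 + ‖μ‖ * (-μ.im)⁻¹)) * ‖h‖ := fun h => by
    set f := e.symm h with hf
    have h0 : T (toDomain T f) - μ • (toDomain T f : H) = h := he h
    have h1 : ‖(toDomain T f : H)‖ ≤ (-μ.im)⁻¹ * ‖h‖ := by
      rw [le_inv_mul_iff₀ (by linarith), ← h0]
      exact hT.dissipative.norm_le μ _
    have h2 : ‖T (toDomain T f)‖ ≤ ‖h‖ + ‖μ‖ * ‖(toDomain T f : H)‖ := by
      rw [← norm_smul, ← h0]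
      simpa using norm_add_le (T (toDomain T f) - μ • (toDomain T f : H))
        (μ • (toDomain T f : H))
    have h3 : ‖f‖ ≤ ‖T (toDomain T f)‖ + ‖(toDomain T f : H)‖ := by
      refine abs_le_of_sq_le_sq' ?_ (by positivity) |>.2
      rw [norm_sq]
      nlinarith [mul_nonneg (norm_nonneg (T (toDomain T f))) (norm_nonneg (toDomain T f : H))]
    have h4 := mul_le_mul_of_nonneg_left h1 (norm_nonneg μ)
    nlinarith
  refine ⟨e.symm.toLinearMap.mkContinuous _ hbound, fun h => he h, fun f => ?_⟩
  exact e.symm_apply_apply f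

end HPlus

/-- If `T - conj z : H_T^+ → H` is an isomorphism, then so is its adjoint `T^× - z`. -/
theorem isInvertible_opCrossSub {H : Type*} [NormedAddCommGroup H] [InnerProductSpace ℂ H]
    [CompleteSpace H] {T : H →ₗ.[ℂ] H} (hT : T.IsMaxDissipative) {z : ℂ} (hz : 0 < z.im) :
    (opCrossSub T z).IsInvertible := by
  obtain ⟨R, hR1, hR2⟩ := HPlus.exists_resolvent hT (μ := conj z) (by simpa using hz)
  have happ : ∀ h f, opCrossSub T z h f =
      inner ℂ (HPlus.opPlus T f - conj z • HPlus.incl T f) h := fun h f => by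
    rw [inner_sub_left, inner_smul_left, Complex.conj_conj]
    rfl
  have hbij : Function.Bijective (opCrossSub T z) := by
    constructor
    · refine (injective_iff_map_eq_zero _).2 fun h hh => ?_
      have := happ h (R h)
      rw [hR1, hh] at this
      exact inner_self_eq_zero.1 this.symm
    · intro φ
      -- `g ↦ conj (φ ((T - conj z)⁻¹ g))` is a bounded linear functional on `H`
      let ψ : H →L[ℂ] ℂ := LinearMap.mkContinuous
        { toFun := fun g => conj (φ (R g))
          map_add' := fun a b => by simp
          map_smul' := fun c a => by simp } (‖φ‖ * ‖R‖) (fun g => by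
            change ‖conj (φ (R g))‖ ≤ _
            rw [RCLike.norm_conj, mul_assoc]
            exact (φ.le_opNorm _).trans
              (mul_le_mul_of_nonneg_left (R.le_opNorm g) (norm_nonneg _)))
      refine ⟨(InnerProductSpace.toDual ℂ H).symm ψ, ?_⟩
      ext f
      rw [happ, ← inner_conj_symm, InnerProductSpace.toDual_symm_apply]
      change conj (conj (φ (R _))) = _
      rw [hR2, Complex.conj_conj]
  let e := ContinuousLinearEquiv.ofBijective (𝕜 := ℂ) (𝕜' := ℂ) (σ := RingHom.id ℂ) (E := H)
    (F := HMinus T) (opCrossSub T z)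
    (LinearMap.ker_eq_bot.2 hbij.1) (LinearMap.range_eq_top.2 hbij.2)
  exact ⟨e, ContinuousLinearMap.ext fun _ => rfl⟩

/-! ### Graphs of the symmetric operator and of the lifting -/

namespace LinearPMap

variable {H : Type*} [NormedAddCommGroup H] [InnerProductSpace ℂ H] [CompleteSpace H]
  {S : H →ₗ.[ℂ] H}

theorem mem_graph_adjoint_iff (hS : Dense (S.domain : Set H)) {p q : H} :
    (p, q) ∈ S.adjoint.graph ↔ ∀ f : S.domain, inner ℂ (S f) p - inner ℂ (f : H) q = 0 := by
  rw [adjoint_graph_eq_graph_adjoint hS, Submodule.mem_adjoint_iff]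
  constructor
  · exact fun h f => h _ _ (S.mem_graph f)
  · rintro h a b hab
    obtain ⟨u, rfl, rfl⟩ := (S.mem_graph_iff).1 hab
    exact h u

end LinearPMap

section

variable {H E : Type*}

@[simp] theorem hsum_fst (h : H) (e : E) : (hsum h e).fst = h := rfl

@[simp] theorem hsum_snd (h : H) (e : E) : (hsum h e).snd = e := rfl

theorem hsum_ext {x y : WithLp 2 (H × E)} (h₁ : x.fst = y.fst) (h₂ : x.snd = y.snd) : x = y :=
  WithLp.ofLp_injective 2 (Prod.ext h₁ h₂)

theorem hsum_inj {h h' : H} {e e' : E} : hsum h e = hsum h' e' ↔ h = h' ∧ e = e' :=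
  ⟨fun hh => ⟨congrArg WithLp.fst hh, congrArg WithLp.snd hh⟩, fun hh => by rw [hh.1, hh.2]⟩

theorem inner_hsum_left [NormedAddCommGroup H] [InnerProductSpace ℂ H] [NormedAddCommGroup E]
    [InnerProductSpace ℂ E] (h : H) (e : E) (x : WithLp 2 (H × E)) :
    inner ℂ (hsum h e) x = inner ℂ h x.fst + inner ℂ e x.snd := WithLp.prod_inner_apply _ _

end

/-- `z - conj z = 2i (√(Im z))²` in the upper half-plane. -/
theorem sub_conj_eq_two_I_mul_sqrt_sq {z : ℂ} (hz : 0 < z.im) :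
    z - conj z = 2 * Complex.I * (Real.sqrt z.im : ℂ) ^ 2 := by
  rw [← Complex.ofReal_pow, Real.sq_sqrt hz.le]
  apply Complex.ext <;> simp
  ring

theorem sqrt_im_ne_zero {z : ℂ} (hz : 0 < z.im) : (Real.sqrt z.im : ℂ) ≠ 0 :=
  Complex.ofReal_ne_zero.2 (Real.sqrt_ne_zero'.2 hz)

namespace BoundaryPair

variable {H : Type*} [NormedAddCommGroup H] [InnerProductSpace ℂ H]
  {E : Type*} [NormedAddCommGroup E] [InnerProductSpace ℂ E]
  {T : H →ₗ.[ℂ] H} (P : BoundaryPair T E)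

theorem imForm_eq (f : T.domain) : T.imForm f = ‖P.Γ f‖ ^ 2 := (P.norm_sq_eq f).symm

/-- `‖Γ f‖² = Im (T f, f)`, so `Γ` tends to zero where the form does. -/
theorem tendsto_Γ_zero {u : ℕ → T.domain}
    (hu : Filter.Tendsto (fun n => T.imForm (u n)) Filter.atTop (𝓝 0)) :
    Filter.Tendsto (fun n => P.Γ (u n)) Filter.atTop (𝓝 0) := by
  rw [tendsto_zero_iff_norm_tendsto_zero]
  have := (Real.continuous_sqrt.tendsto 0).comp hu
  rw [Real.sqrt_zero] at this
  refine this.congr fun n => ?_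
  rw [Function.comp_apply, P.imForm_eq, Real.sqrt_sq (norm_nonneg _)]

theorem mem_hermDomain_iff {f : H} : f ∈ T.hermDomain ↔ ∃ hf : f ∈ T.domain, P.Γ ⟨f, hf⟩ = 0 := by
  refine exists_congr fun hf => ?_
  rw [P.imForm_eq, sq_eq_zero_iff, norm_eq_zero]

theorem graphEmb_apply (z : ℂ) (f : T.domain) :
    P.graphEmb z f = hsum (f : H) (-(1 / (Real.sqrt z.im : ℂ)) • P.Γ f) := rfl

theorem graphVal_apply (z : ℂ) (f : T.domain) :
    P.graphVal z f = hsum (T f) (-(conj z / (Real.sqrt z.im : ℂ)) • P.Γ f) := rfl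

theorem mem_graph_symOp_iff {z : ℂ} {x y : WithLp 2 (H × E)} :
    (x, y) ∈ (P.symOp z).graph ↔ ∃ f : T.domain, x = P.graphEmb z f ∧ y = P.graphVal z f := by
  rw [LinearPMap.mem_graph_iff]
  constructor
  · rintro ⟨⟨_, f, rfl⟩, rfl, rfl⟩
    exact ⟨f, rfl, P.symOp_apply z f⟩
  · rintro ⟨f, rfl, rfl⟩
    exact ⟨⟨_, LinearMap.mem_range_self _ f⟩, rfl, P.symOp_apply z f⟩

theorem mem_domain_symOp_iff {z : ℂ} {x : WithLp 2 (H × E)} :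
    x ∈ (P.symOp z).domain ↔ ∃ f : T.domain, x = P.graphEmb z f :=
  exists_congr fun _ => eq_comm

theorem mem_graph_lift_iff {z : ℂ} {x y : WithLp 2 (H × E)} :
    (x, y) ∈ (P.lift z).graph ↔ ∃ (f : T.domain) (e : E), x = hsum (f : H) e ∧
      y = hsum (T f) ((2 * Complex.I * (Real.sqrt z.im : ℂ)) • P.Γ f + z • e) := by
  rw [LinearPMap.mem_graph_iff]
  constructor
  · rintro ⟨x, rfl, rfl⟩
    exact ⟨⟨x.1.fst, x.2⟩, x.1.snd, rfl, rfl⟩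
  · rintro ⟨f, e, rfl, rfl⟩
    exact ⟨⟨hsum (f : H) e, f.2⟩, rfl, rfl⟩

/-- The form of the lifting is a square: `Im (T̃ (f ⊕ e), f ⊕ e) = ‖Γ f + √(Im z) e‖²`. -/
theorem imForm_lift {z : ℂ} (hz : 0 < z.im) (x : (P.lift z).domain) :
    (P.lift z).imForm x = ‖P.Γ ⟨x.1.fst, x.2⟩ + (Real.sqrt z.im : ℂ) • x.1.snd‖ ^ 2 := by
  set f : T.domain := ⟨x.1.fst, x.2⟩ with hf
  set e : E := x.1.snd
  set s : ℝ := Real.sqrt z.im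
  have hs : z.im = s ^ 2 := (Real.sq_sqrt hz.le).symm
  have h1 : (P.lift z).imForm x = (inner ℂ (f : H) (T f) +
    inner ℂ e ((2 * Complex.I * (s : ℂ)) • P.Γ f + z • e)).im :=
    congrArg Complex.im (WithLp.prod_inner_apply _ _)
  have h2 : inner ℂ e e = ((‖e‖ ^ 2 : ℝ) : ℂ) := by
    rw [inner_self_eq_norm_sq_to_K]
    norm_cast
  have h3 : (inner ℂ (P.Γ f) ((s : ℂ) • e)).re = s * (inner ℂ e (P.Γ f)).re := by
    rw [inner_smul_right, Complex.re_ofReal_mul, ← inner_conj_symm, Complex.conj_re]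
  have h4 : ‖(s : ℂ) • e‖ ^ 2 = s ^ 2 * ‖e‖ ^ 2 := by
    rw [norm_smul, mul_pow, Complex.norm_real, Real.norm_eq_abs, sq_abs]
  rw [h1, norm_add_sq (𝕜 := ℂ), RCLike.re_eq_complex_re, h3, h4, Complex.add_im,
    ← P.norm_sq_eq, inner_add_right, inner_smul_right, inner_smul_right, h2, Complex.add_im,
    Complex.im_mul_ofReal, hs,
    show 2 * Complex.I * (s : ℂ) * inner ℂ e (P.Γ f)
      = Complex.I * (((2 * s : ℝ) : ℂ) * inner ℂ e (P.Γ f)) by push_cast; ring,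
    Complex.I_mul_im, Complex.re_ofReal_mul]
  ring

/-- The lifting is dissipative with `T̃ - μ` onto for `Im μ < 0`, by back substitution in the
triangular system. -/
theorem isMaxDissipative_lift [CompleteSpace H] (hT : T.IsMaxDissipative) {z : ℂ}
    (hz : 0 < z.im) : (P.lift z).IsMaxDissipative := by
  have hdiss : (P.lift z).IsDissipative := fun x => by
    rw [P.imForm_lift hz]
    positivity
  have hdense : Dense ((P.lift z).domain : Set (WithLp 2 (H × E))) := by
    have : Dense ((T.domain : Set H) ×ˢ (Set.univ : Set E)) := hT.dense.prod dense_univ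
    refine (this.preimage (WithLp.homeomorphProd 2 H E).isOpenMap).mono ?_
    rintro x ⟨hx, -⟩
    exact hx
  refine hdiss.isMaxDissipative hdense (μ := -Complex.I) (by simp) fun h => ?_
  obtain ⟨f, hf⟩ := hT.exists_sub_smul_eq (μ := -Complex.I) (by simp) h.fst
  have hne : z - (-Complex.I) ≠ 0 := fun h0 => by
    have := congrArg Complex.im h0
    simp at this
    linarith
  set v := (2 * Complex.I * (Real.sqrt z.im : ℂ)) • P.Γ f
  refine ⟨⟨hsum (f : H) ((z - (-Complex.I))⁻¹ • (h.snd - v)), f.2⟩, hsum_ext hf ?_⟩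
  change v + z • ((z - (-Complex.I))⁻¹ • (h.snd - v)) -
    (-Complex.I) • ((z - (-Complex.I))⁻¹ • (h.snd - v)) = h.snd
  rw [add_sub_assoc, ← sub_smul, smul_inv_smul₀ hne]
  abel

/-- `T̃` acts as `T_z` on the vectors `f ⊕ (-Γ f / √(Im z))`. -/
theorem symOp_le_lift {z : ℂ} (hz : 0 < z.im) : P.symOp z ≤ P.lift z := by
  refine LinearPMap.le_of_le_graph ?_
  rintro ⟨x, y⟩ hxy
  obtain ⟨f, rfl, rfl⟩ := P.mem_graph_symOp_iff.1 hxy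
  refine P.mem_graph_lift_iff.2 ⟨f, _, P.graphEmb_apply z f, ?_⟩
  have h0 := sqrt_im_ne_zero hz
  rw [P.graphVal_apply, hsum_inj, smul_smul, ← add_smul]
  refine ⟨rfl, congrArg (· • P.Γ f) ?_⟩
  have h1 := sub_conj_eq_two_I_mul_sqrt_sq hz
  field_simp
  linear_combination h1

theorem isHermitianPart_symOp {z : ℂ} (hz : 0 < z.im) :
    (P.symOp z).IsHermitianPart (P.lift z) where
  domain_eq := by
    have h0 := sqrt_im_ne_zero hz
    ext x
    rw [SetLike.mem_coe, P.mem_domain_symOp_iff]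
    constructor
    · rintro ⟨f, rfl⟩
      refine ⟨f.2, ?_⟩
      rw [P.imForm_lift hz, sq_eq_zero_iff, norm_eq_zero]
      change P.Γ f + (Real.sqrt z.im : ℂ) • (-(1 / (Real.sqrt z.im : ℂ)) • P.Γ f) = 0
      rw [smul_smul, mul_neg, mul_one_div_cancel h0]
      module
    · rintro ⟨hx, hx0⟩
      rw [P.imForm_lift hz, sq_eq_zero_iff, norm_eq_zero] at hx0
      refine ⟨⟨x.fst, hx⟩, hsum_ext rfl ?_⟩
      rw [P.graphEmb_apply, hsum_snd, eq_neg_of_add_eq_zero_left hx0, smul_neg, neg_smul, neg_neg,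
        smul_smul, one_div_mul_cancel h0, one_smul]
  le := P.symOp_le_lift hz

theorem isSymm_symOp {z : ℂ} (hz : 0 < z.im) : (P.symOp z).IsSymm := fun x => by
  have hp := P.isHermitianPart_symOp hz
  have hx : (x : WithLp 2 (H × E)) ∈ (P.lift z).hermDomain := hp.domain_eq ▸ x.2
  obtain ⟨h1, h2⟩ := hx
  have h3 : P.symOp z x = P.lift z ⟨x, h1⟩ := hp.le.2 rfl
  unfold LinearPMap.imForm at h2 ⊢
  rw [h3, h2]

/-- The graph of `T_z` is cut out of the closed graph of the lifting by the closed condition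
`Im ⟪x, y⟫ = 0`. -/
theorem isClosed_symOp [CompleteSpace H] (hT : T.IsMaxDissipative) {z : ℂ} (hz : 0 < z.im) :
    (P.symOp z).IsClosed := by
  have hp := P.isHermitianPart_symOp hz
  have hset : ((P.symOp z).graph : Set (WithLp 2 (H × E) × WithLp 2 (H × E))) =
      ((P.lift z).graph : Set (WithLp 2 (H × E) × WithLp 2 (H × E))) ∩
        {p | (inner ℂ p.1 p.2).im = 0} := by
    ext ⟨x, y⟩
    constructor
    · intro h
      refine ⟨LinearPMap.le_graph_of_le hp.le h, ?_⟩
      obtain ⟨u, rfl, rfl⟩ := (LinearPMap.mem_graph_iff _).1 h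
      exact P.isSymm_symOp hz u
    · rintro ⟨h, h0⟩
      obtain ⟨u, rfl, rfl⟩ := (LinearPMap.mem_graph_iff _).1 h
      have hu : (u : WithLp 2 (H × E)) ∈ (P.symOp z).domain := by
        rw [← SetLike.mem_coe, hp.domain_eq]
        exact ⟨u.2, h0⟩
      exact (LinearPMap.mem_graph_iff _).2 ⟨⟨u, hu⟩, rfl, hp.le.2 rfl⟩
  change _root_.IsClosed _
  rw [hset]
  exact (P.isMaxDissipative_lift hT hz).isClosed.inter
    (isClosed_eq (by fun_prop) continuous_const)

/-! ### Deficiency subspaces and the adjoint -/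

theorem inner_graphVal_sub_inner_graphEmb (z : ℂ) (f : T.domain) (p q : WithLp 2 (H × E)) :
    inner ℂ (P.graphVal z f) p - inner ℂ (P.graphEmb z f) q =
      inner ℂ (T f) p.fst - inner ℂ (f : H) q.fst -
        1 / (Real.sqrt z.im : ℂ) * inner ℂ (P.Γ f) (z • p.snd - q.snd) := by
  rw [P.graphVal_apply, P.graphEmb_apply, inner_hsum_left, inner_hsum_left, inner_smul_left,
    inner_smul_left, inner_sub_right, inner_smul_right]
  simp only [map_neg, map_div₀, Complex.conj_conj, Complex.conj_ofReal, map_one]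
  ring

theorem opCrossSub_apply (μ : ℂ) (h : H) (f : HPlus T) :
    opCrossSub T μ h f = inner ℂ (T (HPlus.toDomain T f)) h -
      μ * inner ℂ (HPlus.toDomain T f : H) h := rfl

theorem gammaCross_apply (e : E) (f : HPlus T) :
    P.gammaCross e f = inner ℂ (P.Γ (HPlus.toDomain T f)) e := rfl

theorem hsum_mem_deficiencySpace_iff {z : ℂ} (μ : ℂ) (h : H) (y : E) :
    hsum h y ∈ (P.symOp z).deficiencySpace μ ↔
      opCrossSub T μ h = ((z - μ) / (Real.sqrt z.im : ℂ)) • P.gammaCross y := by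
  have key : ∀ f : T.domain, inner ℂ (P.graphVal z f - conj μ • P.graphEmb z f) (hsum h y) =
      (inner ℂ (T f) h - μ * inner ℂ (f : H) h) -
        (z - μ) / (Real.sqrt z.im : ℂ) * inner ℂ (P.Γ f) y := fun f => by
    rw [inner_sub_left, inner_smul_left, Complex.conj_conj, ← inner_smul_right,
      P.inner_graphVal_sub_inner_graphEmb]
    simp only [hsum_fst, hsum_snd, WithLp.smul_fst, WithLp.smul_snd, inner_sub_right,
      inner_smul_right]
    ring
  rw [LinearPMap.deficiencySpace, Submodule.mem_orthogonal]
  constructor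
  · intro hy
    ext f
    have h1 := hy (P.graphVal z (HPlus.toDomain T f) -
      conj μ • P.graphEmb z (HPlus.toDomain T f))
      ⟨⟨_, LinearMap.mem_range_self _ (HPlus.toDomain T f)⟩, by
        rw [← P.symOp_apply]; rfl⟩
    rw [key, sub_eq_zero] at h1
    exact h1
  · rintro hy _ ⟨⟨_, f, rfl⟩, rfl⟩
    change inner ℂ (P.symOp z ⟨P.graphEmb z f, _⟩ - conj μ • P.graphEmb z f) (hsum h y) = 0
    rw [P.symOp_apply, key, sub_eq_zero]
    exact DFunLike.congr_fun hy ((HPlus.toDomain T).symm f)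

theorem deficiencySpace_symOp (z μ : ℂ) :
    ((P.symOp z).deficiencySpace μ : Set (WithLp 2 (H × E))) =
      {x | ∃ (h : H) (y : E), x = hsum h y ∧
        opCrossSub T μ h = ((z - μ) / (Real.sqrt z.im : ℂ)) • P.gammaCross y} := by
  ext x
  constructor
  · intro hx
    exact ⟨x.fst, x.snd, rfl, (P.hsum_mem_deficiencySpace_iff μ x.fst x.snd).1 hx⟩
  · rintro ⟨h, y, rfl, hy⟩
    exact (P.hsum_mem_deficiencySpace_iff μ h y).2 hy

theorem deficiencySpace_symOp_self [CompleteSpace H] (hT : T.IsMaxDissipative) {z : ℂ}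
    (hz : 0 < z.im) :
    ((P.symOp z).deficiencySpace z : Set (WithLp 2 (H × E))) = {x | ∃ y : E, x = hsum 0 y} := by
  have h0 : ∀ y, (0 : ℂ) • P.gammaCross y = 0 := fun y => by
    ext f
    exact zero_mul _
  rw [deficiencySpace_symOp]
  ext x
  constructor
  · rintro ⟨h, y, rfl, hy⟩
    rw [sub_self, zero_div, h0] at hy
    rw [(map_eq_zero_iff _ (isInvertible_opCrossSub hT hz).injective).1 hy]
    exact ⟨y, rfl⟩
  · rintro ⟨y, rfl⟩
    exact ⟨0, y, rfl, by rw [map_zero, sub_self, zero_div, h0]⟩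

/-- The domain `{f ⊕ (-Γ f / √(Im z))}` is dense iff the graph of `Γ` is dense in `H ⊕ E`. As
`‖Γ f‖² = Im (T f, f)`, singularity says that `f ⊕ 0` is in the closure for `f ∈ dom T`, and then
so are `0 ⊕ Γ f` and, by density of `ran Γ`, all of `0 ⊕ E`. -/
theorem dense_domain_symOp_iff (hT : T.IsMaxDissipative) {z : ℂ} (hz : 0 < z.im) :
    Dense ((P.symOp z).domain : Set (WithLp 2 (H × E))) ↔ T.IsDSing := by
  have h0 := sqrt_im_ne_zero hz
  constructor
  · refine fun hd => ⟨hT, fun f => ?_⟩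
    obtain ⟨x, hx, hxf⟩ := mem_closure_iff_seq_limit.1 (hd (hsum (f : H) (0 : E)))
    choose u hu using fun n => P.mem_domain_symOp_iff.1 (hx n)
    refine ⟨u, ?_, ?_⟩
    · have := ((WithLp.prod_continuous_ofLp 2 H E).fst.tendsto _).comp hxf
      refine this.congr fun n => ?_
      change (x n).fst = _
      rw [hu, graphEmb_apply, hsum_fst]
    · have h1 := ((((WithLp.prod_continuous_ofLp 2 H E).snd.const_smul
        (-(Real.sqrt z.im : ℂ))).norm.pow 2).tendsto _).comp hxf
      have h2 : ‖(-(Real.sqrt z.im : ℂ)) • (hsum (f : H) (0 : E)).snd‖ ^ 2 = 0 := by simp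
      rw [← h2]
      refine h1.congr fun n => ?_
      change ‖(-(Real.sqrt z.im : ℂ)) • (x n).snd‖ ^ 2 = _
      rw [hu, graphEmb_apply, hsum_snd, smul_smul, neg_mul_neg, mul_one_div_cancel h0, one_smul,
        P.imForm_eq]
  · rintro ⟨-, hs⟩
    let D := (P.symOp z).domain.topologicalClosure
    have hcont : Continuous fun p : H × E => hsum p.1 p.2 := WithLp.prod_continuous_toLp 2 H E
    have hDc : IsClosed (D : Set (WithLp 2 (H × E))) := Submodule.isClosed_topologicalClosure _
    have hemb : ∀ f : T.domain, P.graphEmb z f ∈ D := fun f =>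
      Submodule.le_topologicalClosure _ (P.mem_domain_symOp_iff.2 ⟨f, rfl⟩)
    have h1 : ∀ f : T.domain, hsum (f : H) (0 : E) ∈ D := fun f => by
      obtain ⟨u, hu, hu0⟩ := hs f
      have hΓ : Filter.Tendsto (fun n => P.Γ (u n)) Filter.atTop (𝓝 0) :=
        P.tendsto_Γ_zero hu0
      have h2 := hΓ.const_smul (-(1 / (Real.sqrt z.im : ℂ)))
      rw [smul_zero] at h2
      exact hDc.mem_of_tendsto ((hcont.tendsto _).comp (hu.prodMk_nhds h2))
        (Filter.Eventually.of_forall fun n => hemb (u n))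
    have h2 : ∀ h : H, hsum h (0 : E) ∈ D := fun h =>
      (hDc.preimage (hcont.comp (continuous_id.prodMk continuous_const))).closure_subset_iff.2
        (fun f hf => h1 ⟨f, hf⟩) (hT.dense h)
    have h3 : ∀ e : E, hsum (0 : H) e ∈ D := fun e => by
      refine (hDc.preimage (hcont.comp (continuous_const.prodMk
        continuous_id))).closure_subset_iff.2 ?_ (P.denseRange e)
      rintro _ ⟨f, rfl⟩
      have h4 := D.smul_mem (-(Real.sqrt z.im : ℂ)) (D.sub_mem (hemb f) (h1 f))
      have h5 : (-(Real.sqrt z.im : ℂ)) • (P.graphEmb z f - hsum (f : H) (0 : E)) =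
          hsum 0 (P.Γ f) := by
        refine hsum_ext ?_ ?_
        · simp [graphEmb_apply]
        · simp only [graphEmb_apply, WithLp.smul_snd, WithLp.sub_snd, hsum_snd, sub_zero,
            smul_smul, neg_mul_neg, mul_one_div_cancel h0, one_smul]
      change hsum 0 (P.Γ f) ∈ D
      exact h5 ▸ h4
    intro x
    have h4 : x = hsum x.fst (0 : E) + hsum (0 : H) x.snd := by
      refine hsum_ext ?_ ?_ <;> simp
    change x ∈ D
    rw [h4]
    exact D.add_mem (h2 _) (h3 _)

/-- `X = (T^× - z)⁻¹ Γ^×` is characterized by `⟪(T - conj z) f, X y⟫ = ⟪Γ f, y⟫`, `f ∈ dom T`. -/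
theorem inner_crossResolventGamma [CompleteSpace H] (hT : T.IsMaxDissipative) {z : ℂ}
    (hz : 0 < z.im) (y : E) (f : T.domain) :
    inner ℂ (T f) (P.crossResolventGamma z y) =
      z * inner ℂ (f : H) (P.crossResolventGamma z y) + inner ℂ (P.Γ f) y := by
  have h := DFunLike.congr_fun ((isInvertible_opCrossSub hT hz).self_apply_inverse
    (P.gammaCross y)) ((HPlus.toDomain T).symm f)
  rw [opCrossSub_apply, gammaCross_apply, LinearEquiv.apply_symm_apply] at h
  exact sub_eq_iff_eq_add'.1 h

section Adjoint

variable [CompleteSpace H] [CompleteSpace E]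

theorem mem_graph_adjoint_symOp_iff {z : ℂ}
    (hd : Dense ((P.symOp z).domain : Set (WithLp 2 (H × E)))) {p q : WithLp 2 (H × E)} :
    (p, q) ∈ (P.symOp z).adjoint.graph ↔ ∀ f : T.domain,
      inner ℂ (T f) p.fst - inner ℂ (f : H) q.fst =
        1 / (Real.sqrt z.im : ℂ) * inner ℂ (P.Γ f) (z • p.snd - q.snd) := by
  rw [LinearPMap.mem_graph_adjoint_iff hd]
  constructor
  · intro h f
    have := h ⟨_, LinearMap.mem_range_self _ f⟩
    rwa [P.symOp_apply, P.inner_graphVal_sub_inner_graphEmb, sub_eq_zero] at this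
  · rintro h ⟨_, f, rfl⟩
    rw [P.symOp_apply, P.inner_graphVal_sub_inner_graphEmb, sub_eq_zero]
    exact h f

theorem exists_eq_of_mem_domain_adjoint_symOp (hT : T.IsDSing) {z : ℂ} (hz : 0 < z.im)
    {x : WithLp 2 (H × E)} (hx : x ∈ (P.symOp z).adjoint.domain) :
    ∃ (f : T.adjoint.domain) (y w : E), x = hsum ((f : H) +
      (2 * Complex.I * (Real.sqrt z.im : ℂ)) • P.crossResolventGamma z y) (y + w) := by
  have h0 := sqrt_im_ne_zero hz
  obtain ⟨q, hq⟩ := LinearPMap.mem_domain_iff.1 hx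
  rw [P.mem_graph_adjoint_symOp_iff ((P.dense_domain_symOp_iff hT.1 hz).2 hT)] at hq
  set s : ℂ := (Real.sqrt z.im : ℂ)
  -- the component `y` is forced by `z x₂ - q₂ = (z - conj z) y`
  let y : E := (2 * Complex.I * s ^ 2)⁻¹ • (z • x.snd - q.snd)
  have hy : z • x.snd - q.snd = (2 * Complex.I * s ^ 2) • y :=
    (smul_inv_smul₀ (by simp [h0]) _).symm
  set X := P.crossResolventGamma z y
  have hmem : (x.fst - (2 * Complex.I * s) • X, q.fst - (2 * Complex.I * s * z) • X) ∈
      T.adjoint.graph := by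
    rw [LinearPMap.mem_graph_adjoint_iff hT.1.dense]
    intro f
    have h1 := hq f
    rw [hy, inner_smul_right] at h1
    rw [inner_sub_right, inner_sub_right, inner_smul_right, inner_smul_right,
      P.inner_crossResolventGamma hT.1 hz]
    have h2 : 1 / s * (2 * Complex.I * s ^ 2 * inner ℂ (P.Γ f) y) =
        2 * Complex.I * s * inner ℂ (P.Γ f) y := by
      field_simp
    rw [h2] at h1
    linear_combination h1
  refine ⟨⟨_, LinearPMap.mem_domain_of_mem_graph hmem⟩, y, x.snd - y, hsum_ext ?_ ?_⟩
  · change x.fst = x.fst - _ + _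
    rw [sub_add_cancel]
  · rw [hsum_snd, add_sub_cancel]

theorem exists_adjoint_symOp_apply (hT : T.IsDSing) {z : ℂ} (hz : 0 < z.im)
    (f : T.adjoint.domain) (y w : E) :
    ∃ hx : hsum ((f : H) +
        (2 * Complex.I * (Real.sqrt z.im : ℂ)) • P.crossResolventGamma z y) (y + w) ∈
        (P.symOp z).adjoint.domain,
      (P.symOp z).adjoint ⟨_, hx⟩ =
        hsum (T.adjoint f +
          (2 * Complex.I * z * (Real.sqrt z.im : ℂ)) • P.crossResolventGamma z y)
          (conj z • y + z • w) := by
  have h0 := sqrt_im_ne_zero hz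
  have h1 := sub_conj_eq_two_I_mul_sqrt_sq hz
  have hmem := (P.mem_graph_adjoint_symOp_iff ((P.dense_domain_symOp_iff hT.1 hz).2 hT)
    (p := hsum ((f : H) +
      (2 * Complex.I * (Real.sqrt z.im : ℂ)) • P.crossResolventGamma z y) (y + w))
    (q := hsum (T.adjoint f +
      (2 * Complex.I * z * (Real.sqrt z.im : ℂ)) • P.crossResolventGamma z y)
      (conj z • y + z • w))).2 fun g => by
    have h2 := (LinearPMap.mem_graph_adjoint_iff hT.1.dense).1 (T.adjoint.mem_graph f) g
    have h3 : z • (y + w) - (conj z • y + z • w) = (z - conj z) • y := by module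
    rw [hsum_fst, hsum_fst, hsum_snd, hsum_snd, h3, h1, inner_smul_right, inner_add_right,
      inner_add_right, inner_smul_right, inner_smul_right, P.inner_crossResolventGamma hT.1 hz]
    field_simp
    linear_combination h2
  have hx := LinearPMap.mem_domain_of_mem_graph hmem
  exact ⟨hx, ((LinearPMap.image_iff hx).2 hmem).symm⟩

/-- In `dom T_z*` the second component is free and the condition on the first one does not
mention `z`. -/
theorem mem_domain_adjoint_symOp_iff (hT : T.IsDSing) {z : ℂ} (hz : 0 < z.im)
    {x : WithLp 2 (H × E)} :
    x ∈ (P.symOp z).adjoint.domain ↔ ∃ (k : H) (v : E), ∀ f : T.domain,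
      inner ℂ (T f) x.fst - inner ℂ (f : H) k = inner ℂ (P.Γ f) v := by
  have h0 := sqrt_im_ne_zero hz
  have hd := (P.dense_domain_symOp_iff hT.1 hz).2 hT
  rw [LinearPMap.mem_domain_iff]
  constructor
  · rintro ⟨q, hq⟩
    rw [P.mem_graph_adjoint_symOp_iff hd] at hq
    refine ⟨q.fst, (1 / (Real.sqrt z.im : ℂ)) • (z • x.snd - q.snd), fun f => ?_⟩
    rw [inner_smul_right, hq]
  · rintro ⟨k, v, h⟩
    refine ⟨hsum k (z • x.snd - (Real.sqrt z.im : ℂ) • v), ?_⟩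
    rw [P.mem_graph_adjoint_symOp_iff hd]
    intro f
    rw [hsum_fst, hsum_snd, h, sub_sub_cancel, inner_smul_right, ← mul_assoc,
      one_div_mul_cancel h0, one_mul]

theorem domain_adjoint_symOp_eq (hT : T.IsDSing) {z₁ z₂ : ℂ} (hz₁ : 0 < z₁.im)
    (hz₂ : 0 < z₂.im) : (P.symOp z₁).adjoint.domain = (P.symOp z₂).adjoint.domain := by
  ext x
  rw [P.mem_domain_adjoint_symOp_iff hT hz₁, P.mem_domain_adjoint_symOp_iff hT hz₂]

end Adjoint

end BoundaryPair

namespace BoundaryPair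

variable {H : Type*} [NormedAddCommGroup H] [InnerProductSpace ℂ H]
  {E : Type*} [NormedAddCommGroup E] [InnerProductSpace ℂ E]
  {T : H →ₗ.[ℂ] H} (P : BoundaryPair T E)

/-! ### Congruences -/

theorem blockDiag_graphEmb {z₁ z₂ : ℂ} (hz₁ : 0 < z₁.im) (hz₂ : 0 < z₂.im) (f : T.domain) :
    blockDiag H E 1 (Real.sqrt (z₂.im / z₁.im) : ℂ) (P.graphEmb z₂ f) = P.graphEmb z₁ f := by
  have h₁ := sqrt_im_ne_zero hz₁
  have h₂ := sqrt_im_ne_zero hz₂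
  refine hsum_ext (one_smul ℂ _) ?_
  change (Real.sqrt (z₂.im / z₁.im) : ℂ) • (-(1 / (Real.sqrt z₂.im : ℂ)) • P.Γ f) =
    -(1 / (Real.sqrt z₁.im : ℂ)) • P.Γ f
  rw [smul_smul, Real.sqrt_div hz₂.le]
  push_cast
  congr 1
  field_simp

theorem blockDiag_graphVal {z₁ z₂ : ℂ} (hz₁ : 0 < z₁.im) (hz₂ : 0 < z₂.im) (f : T.domain) :
    blockDiag H E 1 (Real.sqrt (z₂.im / z₁.im) : ℂ)
      (blockDiag H E 0 (((conj z₂ * z₁).im / z₂.im : ℝ) : ℂ) (P.graphEmb z₁ f) +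
        P.graphVal z₁ f) = P.graphVal z₂ f := by
  have h₁ := sqrt_im_ne_zero hz₁
  have h₂ := sqrt_im_ne_zero hz₂
  have h₃ : (z₂.im : ℂ) = (Real.sqrt z₂.im : ℂ) ^ 2 := by
    rw [← Complex.ofReal_pow, Real.sq_sqrt hz₂.le]
  have h₄ : (z₁.im : ℂ) = (Real.sqrt z₁.im : ℂ) ^ 2 := by
    rw [← Complex.ofReal_pow, Real.sq_sqrt hz₁.le]
  -- `Im (conj z₂ z₁) = Im z₁ conj z₂ - Im z₂ conj z₁`
  have h₅ : ((conj z₂ * z₁).im : ℂ) = z₁.im * conj z₂ - z₂.im * conj z₁ := by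
    apply Complex.ext <;> simp <;> ring
  refine hsum_ext ?_ ?_
  · change (1 : ℂ) • ((0 : ℂ) • (f : H) + T f) = T f
    rw [one_smul, zero_smul, zero_add]
  · change (Real.sqrt (z₂.im / z₁.im) : ℂ) • ((((conj z₂ * z₁).im / z₂.im : ℝ) : ℂ) •
      (-(1 / (Real.sqrt z₁.im : ℂ)) • P.Γ f) + -(conj z₁ / (Real.sqrt z₁.im : ℂ)) • P.Γ f) =
      -(conj z₂ / (Real.sqrt z₂.im : ℂ)) • P.Γ f
    rw [smul_smul, ← add_smul, smul_smul, Real.sqrt_div hz₂.le, Complex.ofReal_div,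
      Complex.ofReal_div, h₅, h₃, h₄]
    congr 1
    field_simp
    ring

theorem symOp_apply_of_eq {z : ℂ} {x : WithLp 2 (H × E)} (hx : x ∈ (P.symOp z).domain)
    {f : T.domain} (hf : x = P.graphEmb z f) : P.symOp z ⟨x, hx⟩ = P.graphVal z f := by
  subst hf
  exact P.symOp_apply z f

theorem symOp_eq_congruence {z₁ z₂ : ℂ} (hz₁ : 0 < z₁.im) (hz₂ : 0 < z₂.im) :
    P.symOp z₂ = (blockDiag H E 1 (Real.sqrt (z₂.im / z₁.im) : ℂ)).compPMap
      ((blockDiag H E 0 (((conj z₂ * z₁).im / z₂.im : ℝ) : ℂ) +ᵥ P.symOp z₁).compEverywhere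
        (blockDiag H E 1 (Real.sqrt (z₂.im / z₁.im) : ℂ))) := by
  have hdom : ∀ x, x ∈ (P.symOp z₂).domain ↔
      blockDiag H E 1 (Real.sqrt (z₂.im / z₁.im) : ℂ) x ∈ (P.symOp z₁).domain := fun x => by
    rw [P.mem_domain_symOp_iff, P.mem_domain_symOp_iff]
    have hr : (Real.sqrt (z₂.im / z₁.im) : ℂ) ≠ 0 :=
      Complex.ofReal_ne_zero.2 (Real.sqrt_ne_zero'.2 (div_pos hz₂ hz₁))
    refine exists_congr fun f => ⟨?_, fun h => ?_⟩
    · rintro rfl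
      exact P.blockDiag_graphEmb hz₁ hz₂ f
    · rw [← P.blockDiag_graphEmb hz₁ hz₂ f] at h
      obtain ⟨h1, h2⟩ := hsum_inj.1 h
      exact hsum_ext (smul_right_injective H one_ne_zero h1) (smul_right_injective E hr h2)
  refine LinearPMap.ext (Submodule.ext hdom) fun x hx hx' => ?_
  obtain ⟨f, rfl⟩ := P.mem_domain_symOp_iff.1 hx
  have hD := P.blockDiag_graphEmb hz₁ hz₂ f
  rw [P.symOp_apply_of_eq hx rfl, ← P.blockDiag_graphVal hz₁ hz₂ f, ← hD,
    ← P.symOp_apply_of_eq ((hdom _).1 hx) hD]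
  rfl

end BoundaryPair

/-! ### Simplicity -/

namespace LinearPMap

variable {H : Type*} [NormedAddCommGroup H] [InnerProductSpace ℂ H] {S : H →ₗ.[ℂ] H}

theorem mem_graph_part_iff {K : Submodule ℂ H} (hK : ∀ x : S.domain, (x : H) ∈ K → S x ∈ K)
    {x y : K} : (x, y) ∈ (S.part K hK).graph ↔ ((x : H), (y : H)) ∈ S.graph := by
  rw [mem_graph_iff, mem_graph_iff]
  constructor
  · rintro ⟨u, rfl, rfl⟩
    exact ⟨⟨_, u.2⟩, rfl, rfl⟩
  · rintro ⟨u, hu, hy⟩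
    simp only at hu hy
    refine ⟨⟨x, ?_⟩, rfl, Subtype.ext ?_⟩
    · change (x : H) ∈ S.domain
      rw [← hu]
      exact u.2
    · change S ⟨(x : H), _⟩ = y
      rw [← hy]
      exact congrArg S (Subtype.ext hu.symm)

/-- Selfadjointness of the part of `S` in `K`, expressed through vectors of the ambient space. -/
theorem isSelfAdjoint_part_iff {K : Submodule ℂ H} [CompleteSpace K]
    (hK : ∀ x : S.domain, (x : H) ∈ K → S x ∈ K) :
    IsSelfAdjoint (S.part K hK) ↔
      (∀ x ∈ K, x ∈ _root_.closure ((S.domain : Set H) ∩ K)) ∧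
      ∀ x ∈ K, ∀ y ∈ K, (x, y) ∈ S.graph ↔
        ∀ u : S.domain, (u : H) ∈ K → inner ℂ (S u) x - inner ℂ (u : H) y = 0 := by
  have himage : ((↑) : K → H) '' ((S.part K hK).domain : Set K) = (S.domain : Set H) ∩ K := by
    ext x
    constructor
    · rintro ⟨u, hu, rfl⟩
      exact ⟨hu, u.2⟩
    · rintro ⟨h1, h2⟩
      exact ⟨⟨x, h2⟩, h1, rfl⟩
  have hdense : Dense ((S.part K hK).domain : Set K) ↔
      ∀ x ∈ K, x ∈ _root_.closure ((S.domain : Set H) ∩ K) := by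
    rw [← himage]
    exact ⟨fun h x hx => closure_subtype.1 (h ⟨x, hx⟩), fun h x => closure_subtype.2 (h x x.2)⟩
  have hform : ∀ x y : K, (∀ f : (S.part K hK).domain,
      inner ℂ (S.part K hK f) x - inner ℂ (f : K) y = 0) ↔
      ∀ u : S.domain, (u : H) ∈ K → inner ℂ (S u) (x : H) - inner ℂ (u : H) (y : H) = 0 :=
    fun x y => ⟨fun h u hu => h ⟨⟨u, hu⟩, u.2⟩, fun h f => h ⟨_, f.2⟩ f.1.2⟩
  rw [← hdense]
  constructor
  · refine fun h => ⟨h.dense_domain, fun x hx y hy => ?_⟩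
    rw [← hform ⟨x, hx⟩ ⟨y, hy⟩, ← mem_graph_adjoint_iff h.dense_domain,
      (isSelfAdjoint_def).1 h, mem_graph_part_iff]
  · rintro ⟨hd, h⟩
    refine (isSelfAdjoint_def).2 (eq_of_eq_graph (Submodule.ext ?_))
    rintro ⟨x, y⟩
    rw [mem_graph_adjoint_iff hd, hform, mem_graph_part_iff, h x x.2 y y.2]

end LinearPMap

namespace BoundaryPair

variable {H : Type*} [NormedAddCommGroup H] [InnerProductSpace ℂ H]
  {E : Type*} [NormedAddCommGroup E] [InnerProductSpace ℂ E]
  {T : H →ₗ.[ℂ] H} (P : BoundaryPair T E)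

section Embedded

/-! In this section `K` is the copy `L ⊕ 0` of a subspace `L` of `H`. -/

variable {K : Submodule ℂ (WithLp 2 (H × E))} {L : Submodule ℂ H}

theorem mem_orthogonal_iff_fst (hKL : ∀ x, x ∈ K ↔ x.fst ∈ L ∧ x.snd = 0)
    {x : WithLp 2 (H × E)} : x ∈ Kᗮ ↔ x.fst ∈ Lᗮ := by
  rw [Submodule.mem_orthogonal, Submodule.mem_orthogonal]
  constructor
  · intro h u hu
    have := h (hsum u 0) ((hKL _).2 ⟨hu, rfl⟩)
    rwa [inner_hsum_left, inner_zero_left, add_zero] at this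
  · intro h u hu
    obtain ⟨h1, h2⟩ := (hKL u).1 hu
    rw [WithLp.prod_inner_apply]
    change inner ℂ u.fst x.fst + inner ℂ u.snd x.snd = 0
    rw [h2, inner_zero_left, add_zero, h _ h1]

theorem starProjection_eq_hsum [K.HasOrthogonalProjection] [L.HasOrthogonalProjection]
    (hKL : ∀ x, x ∈ K ↔ x.fst ∈ L ∧ x.snd = 0) (x : WithLp 2 (H × E)) :
    K.starProjection x = hsum (L.starProjection x.fst) 0 := by
  refine Submodule.eq_starProjection_of_mem_orthogonal ?_ ?_
  · exact (hKL _).2 ⟨L.starProjection_apply_mem _, rfl⟩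
  · exact (mem_orthogonal_iff_fst hKL).2 (L.sub_starProjection_mem_orthogonal x.fst)

theorem hsum_zero_eq_graphEmb {z : ℂ} {f : T.domain} (hf : P.Γ f = 0) :
    hsum (f : H) (0 : E) = P.graphEmb z f := by
  rw [graphEmb_apply, hf, smul_zero]

theorem graphVal_eq_hsum_zero {z : ℂ} {f : T.domain} (hf : P.Γ f = 0) :
    P.graphVal z f = hsum (T f) (0 : E) := by
  rw [graphVal_apply, hf, smul_zero]

theorem Γ_eq_zero_of_graphEmb_snd {z : ℂ} (hz : 0 < z.im) {f : T.domain}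
    (hf : (P.graphEmb z f).snd = 0) : P.Γ f = 0 := by
  rw [graphEmb_apply, hsum_snd, smul_eq_zero] at hf
  exact hf.resolve_left (neg_ne_zero.2 (one_div_ne_zero (sqrt_im_ne_zero hz)))

/-- If `Γ` vanishes on `dom T ∩ L`, then `J : h ↦ h ⊕ 0` intertwines the part of `T` in `L` and
the part of `T_z` in `L ⊕ 0`. -/
theorem isSelfAdjoint_part_symOp_iff [CompleteSpace K] [CompleteSpace L] {z : ℂ} (hz : 0 < z.im)
    (hKL : ∀ x, x ∈ K ↔ x.fst ∈ L ∧ x.snd = 0) (hΓ : ∀ u : T.domain, (u : H) ∈ L → P.Γ u = 0)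
    (hK : ∀ x : (P.symOp z).domain, (x : WithLp 2 (H × E)) ∈ K → P.symOp z x ∈ K)
    (hL : ∀ x : T.domain, (x : H) ∈ L → T x ∈ L) :
    IsSelfAdjoint ((P.symOp z).part K hK) ↔ IsSelfAdjoint (T.part L hL) := by
  have hJ : Continuous fun h : H => hsum h (0 : E) :=
    (WithLp.prod_continuous_toLp 2 H E).comp (continuous_id.prodMk continuous_const)
  have hfst : Continuous fun x : WithLp 2 (H × E) => x.fst :=
    (WithLp.prod_continuous_ofLp 2 H E).fst
  have hdom : ∀ u, u ∈ T.domain → u ∈ L → hsum u (0 : E) ∈ (P.symOp z).domain :=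
    fun u hu hu' => P.mem_domain_symOp_iff.2
      ⟨⟨u, hu⟩, P.hsum_zero_eq_graphEmb (f := ⟨u, hu⟩) (hΓ ⟨u, hu⟩ hu')⟩
  have hmemK : ∀ h, hsum h (0 : E) ∈ K ↔ h ∈ L := fun h =>
    (hKL _).trans ⟨fun hh => hh.1, fun hh => ⟨hh, rfl⟩⟩
  have hexK : ∀ x ∈ K, x = hsum x.fst 0 := fun x hx => hsum_ext rfl ((hKL x).1 hx).2
  have hgraph : ∀ x ∈ L, ∀ y, (hsum x (0 : E), hsum y (0 : E)) ∈ (P.symOp z).graph ↔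
      (x, y) ∈ T.graph := fun x hx y => by
    rw [P.mem_graph_symOp_iff]
    constructor
    · rintro ⟨f, hf, hf'⟩
      exact (T.mem_graph_iff).2 ⟨f, (congrArg WithLp.fst hf).symm, (congrArg WithLp.fst hf').symm⟩
    · intro h
      obtain ⟨f, rfl, rfl⟩ := (T.mem_graph_iff).1 h
      exact ⟨f, P.hsum_zero_eq_graphEmb (hΓ f hx), (P.graphVal_eq_hsum_zero (hΓ f hx)).symm⟩
  have hinner : ∀ x y : H, (∀ u : (P.symOp z).domain, (u : WithLp 2 (H × E)) ∈ K →
      inner ℂ (P.symOp z u) (hsum x (0 : E)) -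
        inner ℂ (u : WithLp 2 (H × E)) (hsum y (0 : E)) = 0) ↔
      ∀ u : T.domain, (u : H) ∈ L → inner ℂ (T u) x - inner ℂ (u : H) y = 0 := fun x y => by
    constructor
    · intro h u hu
      have := h ⟨_, hdom u u.2 hu⟩ ((hmemK u).2 hu)
      rw [P.symOp_apply_of_eq _ (P.hsum_zero_eq_graphEmb (hΓ u hu)),
        P.graphVal_eq_hsum_zero (hΓ u hu), inner_hsum_left, inner_hsum_left] at this
      simpa using this
    · rintro h ⟨_, f, rfl⟩ hu
      obtain ⟨h1, h2⟩ := (hKL _).1 hu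
      have h3 := P.Γ_eq_zero_of_graphEmb_snd hz h2
      rw [P.symOp_apply, P.graphVal_eq_hsum_zero h3]
      simp only [← P.hsum_zero_eq_graphEmb h3]
      rw [inner_hsum_left, inner_hsum_left]
      simpa using h f h1
  rw [LinearPMap.isSelfAdjoint_part_iff, LinearPMap.isSelfAdjoint_part_iff]
  refine and_congr ⟨fun h x hx => ?_, fun h x hx => ?_⟩ ⟨fun h x hx y hy => ?_,
    fun h x hx y hy => ?_⟩
  · refine map_mem_closure hfst (h _ ((hmemK x).2 hx)) ?_
    rintro _ ⟨⟨f, rfl⟩, hf⟩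
    exact ⟨f.2, ((hKL _).1 hf).1⟩
  · rw [hexK x hx]
    exact map_mem_closure (f := fun u : H => hsum u (0 : E)) hJ (h _ ((hKL x).1 hx).1)
      fun u hu => ⟨hdom u hu.1 hu.2, (hmemK u).2 hu.2⟩
  · rw [← hgraph x hx y, h _ ((hmemK x).2 hx) _ ((hmemK y).2 hy), hinner]
  · rw [hexK x hx, hexK y hy, hinner, hgraph _ ((hKL x).1 hx).1,
      h _ ((hKL x).1 hx).1 _ ((hKL y).1 hy).1]

end Embedded

theorem Γ_eq_zero_of_isSelfAdjoint_part {L : Submodule ℂ H} [CompleteSpace L]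
    (hL : ∀ x : T.domain, (x : H) ∈ L → T x ∈ L) (hsa : IsSelfAdjoint (T.part L hL))
    (u : T.domain) (hu : (u : H) ∈ L) : P.Γ u = 0 := by
  have h1 := ((LinearPMap.isSelfAdjoint_part_iff hL).1 hsa).2 u hu (T u) (hL u hu)
  have h2 := P.green u u
  rw [← neg_sub, h1.1 (T.mem_graph u) u hu, neg_zero] at h2
  simpa using h2.symm

/-- A subspace that reduces `T_z` to a selfadjoint operator is orthogonal to `0 ⊕ E`: the
projection `n` of `0 ⊕ e` onto it is an eigenvector of the selfadjoint part for the nonreal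
eigenvalue `z`, because `0 ⊕ e` is in the deficiency subspace at `z`. -/
theorem snd_eq_zero_of_isSelfAdjoint_part {z : ℂ} (hz : 0 < z.im)
    {K : Submodule ℂ (WithLp 2 (H × E))} [CompleteSpace K]
    (hK : ∀ x : (P.symOp z).domain, (x : WithLp 2 (H × E)) ∈ K → P.symOp z x ∈ K)
    (hsa : IsSelfAdjoint ((P.symOp z).part K hK)) (x : WithLp 2 (H × E)) (hx : x ∈ K) :
    x.snd = 0 := by
  have hproj : ∀ w ∈ K, ∀ e : E,
      inner ℂ w (K.starProjection (hsum 0 e)) = inner ℂ w (hsum 0 e) := fun w hw e => by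
    have := K.inner_right_of_mem_orthogonal hw
      (K.sub_starProjection_mem_orthogonal (hsum (0 : H) e))
    rw [inner_sub_right, sub_eq_zero] at this
    exact this.symm
  have hn : K.starProjection (hsum 0 x.snd) = 0 := by
    set n := K.starProjection (hsum 0 x.snd) with hn
    have hnK : n ∈ K := K.starProjection_apply_mem _
    have hmem : (n, z • n) ∈ (P.symOp z).graph := by
      rw [((LinearPMap.isSelfAdjoint_part_iff hK).1 hsa).2 n hnK _ (K.smul_mem z hnK)]
      rintro u hu
      rw [inner_smul_right, hn, hproj _ (hK u hu), hproj _ hu, ← inner_smul_right]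
      obtain ⟨_, f, rfl⟩ := u
      rw [P.symOp_apply, P.inner_graphVal_sub_inner_graphEmb]
      simp
    obtain ⟨u, hu, hu'⟩ := (LinearPMap.mem_graph_iff _).1 hmem
    have h1 := P.isSymm_symOp hz u
    simp only at hu hu'
    have h2 : inner ℂ n n = ((‖n‖ ^ 2 : ℝ) : ℂ) := by
      rw [inner_self_eq_norm_sq_to_K]
      norm_cast
    rw [LinearPMap.imForm, hu', hu, inner_smul_right, h2, Complex.im_mul_ofReal] at h1
    simpa using (mul_eq_zero.1 h1).resolve_left hz.ne'
  have h1 := hproj x hx x.snd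
  rw [hn, inner_zero_right, WithLp.prod_inner_apply] at h1
  change 0 = inner ℂ x.fst 0 + inner ℂ x.snd x.snd at h1
  rw [inner_zero_right, zero_add] at h1
  exact inner_self_eq_zero.1 h1.symm

theorem isSimple_of_isSimple_symOp [CompleteSpace H] [CompleteSpace E] {z : ℂ} (hz : 0 < z.im)
    (hA : (P.symOp z).IsSimple) : T.IsSimple := by
  intro L _ hL hsa
  have hΓ := P.Γ_eq_zero_of_isSelfAdjoint_part hL.map_mem hsa
  let K : Submodule ℂ (WithLp 2 (H × E)) :=
    L.comap (WithLp.fstₗ 2 ℂ H E) ⊓ LinearMap.ker (WithLp.sndₗ 2 ℂ H E)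
  have hKL : ∀ x, x ∈ K ↔ x.fst ∈ L ∧ x.snd = 0 := fun x => Iff.rfl
  have hLc : IsClosed (L : Set H) := (completeSpace_coe_iff_isComplete.1 ‹_›).isClosed
  have hKc : IsClosed (K : Set (WithLp 2 (H × E))) :=
    (hLc.preimage (WithLp.prod_continuous_ofLp 2 H E).fst).inter
      (isClosed_eq (WithLp.prod_continuous_ofLp 2 H E).snd continuous_const)
  have : CompleteSpace K := hKc.completeSpace_coe
  have hred : (P.symOp z).Reduces K :=
    { proj_mem := by
        rintro _ ⟨f, rfl⟩
        rw [starProjection_eq_hsum hKL]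
        exact P.mem_domain_symOp_iff.2 ⟨⟨_, hL.proj_mem f f.2⟩,
          P.hsum_zero_eq_graphEmb (f := ⟨_, hL.proj_mem f f.2⟩)
            (hΓ _ (L.starProjection_apply_mem _))⟩
      map_mem := by
        rintro ⟨_, f, rfl⟩ hf
        obtain ⟨h1, h2⟩ := (hKL _).1 hf
        rw [P.symOp_apply, P.graphVal_eq_hsum_zero (P.Γ_eq_zero_of_graphEmb_snd hz h2)]
        exact (hKL _).2 ⟨hL.map_mem f h1, rfl⟩
      map_mem_orthogonal := by
        rintro ⟨_, f, rfl⟩ hf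
        rw [P.symOp_apply]
        exact (mem_orthogonal_iff_fst hKL).2
          (hL.map_mem_orthogonal f ((mem_orthogonal_iff_fst hKL).1 hf)) }
  have hbot := hA K hred
    ((P.isSelfAdjoint_part_symOp_iff hz hKL hΓ hred.map_mem hL.map_mem).2 hsa)
  refine (Submodule.eq_bot_iff _).2 fun h hh => ?_
  have h1 : hsum h (0 : E) ∈ K := (hKL _).2 ⟨hh, rfl⟩
  rw [hbot, Submodule.mem_bot] at h1
  exact congrArg WithLp.fst h1

theorem isSimple_symOp_of_isSimple [CompleteSpace H] [CompleteSpace E] {z : ℂ} (hz : 0 < z.im)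
    (hT : T.IsSimple) : (P.symOp z).IsSimple := by
  intro K _ hK hsa
  have hsnd := P.snd_eq_zero_of_isSelfAdjoint_part hz hK.map_mem hsa
  let J : H →ₗ[ℂ] WithLp 2 (H × E) :=
    (WithLp.linearEquiv 2 ℂ (H × E)).symm.toLinearMap ∘ₗ LinearMap.inl ℂ H E
  let L : Submodule ℂ H := K.comap J
  have hL : ∀ h, h ∈ L ↔ hsum h (0 : E) ∈ K := fun h => Iff.rfl
  have hKL : ∀ x, x ∈ K ↔ x.fst ∈ L ∧ x.snd = 0 := fun x => by
    constructor
    · intro hx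
      have h1 : x = hsum x.fst 0 := hsum_ext rfl (hsnd x hx)
      exact ⟨(hL _).2 (h1 ▸ hx), hsnd x hx⟩
    · rintro ⟨h1, h2⟩
      have h3 : x = hsum x.fst 0 := hsum_ext rfl h2
      exact h3 ▸ (hL _).1 h1
  have hKc : IsClosed (K : Set (WithLp 2 (H × E))) :=
    (completeSpace_coe_iff_isComplete.1 ‹_›).isClosed
  have hLc : IsClosed (L : Set H) := hKc.preimage
    ((WithLp.prod_continuous_toLp 2 H E).comp (continuous_id.prodMk continuous_const))
  have : CompleteSpace L := hLc.completeSpace_coe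
  have hproj : ∀ f : T.domain, ∃ g : T.domain,
      hsum (L.starProjection (f : H)) (0 : E) = P.graphEmb z g := fun f => by
    have h1 := hK.proj_mem _ (P.mem_domain_symOp_iff.2 ⟨f, rfl⟩)
    rw [starProjection_eq_hsum hKL] at h1
    exact P.mem_domain_symOp_iff.1 h1
  have hΓ : ∀ u : T.domain, (u : H) ∈ L → P.Γ u = 0 := fun u hu => by
    obtain ⟨g, hg⟩ := hproj u
    rw [Submodule.starProjection_eq_self_iff.2 hu] at hg
    have h1 : u = g := Subtype.ext (congrArg WithLp.fst hg)
    subst h1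
    exact P.Γ_eq_zero_of_graphEmb_snd hz (congrArg WithLp.snd hg).symm
  have hred : T.Reduces L :=
    { proj_mem := fun f hf => by
        obtain ⟨g, hg⟩ := hproj ⟨f, hf⟩
        have h1 : L.starProjection f = g := congrArg WithLp.fst hg
        exact h1 ▸ g.2
      map_mem := fun f hf => by
        have h1 := hK.map_mem ⟨P.graphEmb z f, P.mem_domain_symOp_iff.2 ⟨f, rfl⟩⟩ (by
          change P.graphEmb z f ∈ K
          rw [← P.hsum_zero_eq_graphEmb (hΓ f hf)]
          exact (hL _).1 hf)
        rw [P.symOp_apply] at h1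
        exact ((hKL _).1 h1).1
      map_mem_orthogonal := fun f hf => by
        have h1 := hK.map_mem_orthogonal ⟨P.graphEmb z f, P.mem_domain_symOp_iff.2 ⟨f, rfl⟩⟩
          ((mem_orthogonal_iff_fst hKL).2 hf)
        rw [P.symOp_apply] at h1
        exact (mem_orthogonal_iff_fst hKL).1 h1 }
  have hbot := hT L hred
    ((P.isSelfAdjoint_part_symOp_iff hz hKL hΓ hK.map_mem hred.map_mem).1 hsa)
  refine (Submodule.eq_bot_iff _).2 fun x hx => ?_
  obtain ⟨h1, h2⟩ := (hKL x).1 hx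
  rw [hbot, Submodule.mem_bot] at h1
  exact hsum_ext h1 h2

/-! ### The square of the symmetric operator -/

/-- `f ⊕ (-Γ f / √(Im z))` is in the domain of `T_z²` iff `(T - conj z) f` is in the Hermitian
domain of `T`. -/
theorem mem_sqDomain_symOp_iff {z : ℂ} (hz : 0 < z.im) {x : WithLp 2 (H × E)} :
    x ∈ (P.symOp z).sqDomain ↔
      ∃ f : T.domain, x = P.graphEmb z f ∧ T f - conj z • (f : H) ∈ T.hermDomain := by
  have h0 := sqrt_im_ne_zero hz
  constructor
  · rintro ⟨⟨_, f, rfl⟩, hf, rfl⟩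
    refine ⟨f, rfl, ?_⟩
    change P.symOp z ⟨P.graphEmb z f, _⟩ ∈ (P.symOp z).domain at hf
    rw [P.symOp_apply, P.mem_domain_symOp_iff] at hf
    obtain ⟨g, hg⟩ := hf
    obtain ⟨h1, h2⟩ := hsum_inj.1 hg
    rw [P.mem_hermDomain_iff, h1]
    refine ⟨(g - conj z • f).2, ?_⟩
    change P.Γ (g - conj z • f) = 0
    rw [map_sub, map_smul, sub_eq_zero]
    have h3 := congrArg ((-(Real.sqrt z.im : ℂ)) • ·) h2
    simp only [smul_smul, neg_mul_neg, mul_div_cancel₀ _ h0, one_smul] at h3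
    exact h3.symm
  · rintro ⟨f, rfl, hf⟩
    obtain ⟨h1, h2⟩ := P.mem_hermDomain_iff.1 hf
    refine ⟨⟨P.graphEmb z f, P.mem_domain_symOp_iff.2 ⟨f, rfl⟩⟩, ?_, rfl⟩
    change P.symOp z ⟨P.graphEmb z f, _⟩ ∈ (P.symOp z).domain
    rw [P.symOp_apply, P.mem_domain_symOp_iff]
    refine ⟨⟨_, h1⟩ + conj z • f, hsum_ext ?_ ?_⟩
    · change T f = T f - conj z • (f : H) + conj z • (f : H)
      rw [sub_add_cancel]
    · rw [graphVal_apply, graphEmb_apply, hsum_snd, hsum_snd, map_add, h2, zero_add, map_smul,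
        smul_smul]
      congr 1
      ring

theorem sqDomain_symOp_eq_bot_iff [CompleteSpace H] (hT : T.IsMaxDissipative) {z : ℂ}
    (hz : 0 < z.im) : (P.symOp z).sqDomain = ⊥ ↔ ∀ f ∈ T.hermDomain, f = 0 := by
  have hz' : (conj z).im < 0 := by simpa using hz
  rw [Submodule.eq_bot_iff]
  constructor
  · intro h g hg
    obtain ⟨f, rfl⟩ := hT.exists_sub_smul_eq hz' g
    have h1 := h _ ((P.mem_sqDomain_symOp_iff hz).2 ⟨f, rfl, hg⟩)
    have h2 : f = 0 := P.graphEmb_injective z (h1.trans (map_zero _).symm)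
    rw [h2, LinearPMap.map_zero, ZeroMemClass.coe_zero, smul_zero, sub_zero]
  · intro h x hx
    obtain ⟨f, rfl, hf⟩ := (P.mem_sqDomain_symOp_iff hz).1 hx
    have h1 : f = 0 := hT.dissipative.eq_of_sub_smul_eq hz' (by
      rw [h _ hf, LinearPMap.map_zero, ZeroMemClass.coe_zero, smul_zero, sub_zero])
    rw [h1, map_zero]

theorem domain_symOp_inf_eq_bot_iff {z₁ z₂ : ℂ} (hz₁ : 0 < z₁.im) (hz₂ : 0 < z₂.im)
    (hne : z₁.im ≠ z₂.im) :
    (P.symOp z₁).domain ⊓ (P.symOp z₂).domain = ⊥ ↔ ∀ f ∈ T.hermDomain, f = 0 := by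
  rw [Submodule.eq_bot_iff]
  constructor
  · intro h f hf
    obtain ⟨h1, h2⟩ := P.mem_hermDomain_iff.1 hf
    have := h (hsum f 0)
      ⟨P.mem_domain_symOp_iff.2 ⟨⟨f, h1⟩, P.hsum_zero_eq_graphEmb (f := ⟨f, h1⟩) h2⟩,
        P.mem_domain_symOp_iff.2 ⟨⟨f, h1⟩, P.hsum_zero_eq_graphEmb (f := ⟨f, h1⟩) h2⟩⟩
    exact congrArg WithLp.fst this
  · rintro h _ ⟨⟨f, rfl⟩, ⟨g, hg⟩⟩
    obtain ⟨h1, h2⟩ := hsum_inj.1 hg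
    have h3 : g = f := Subtype.ext h1
    subst h3
    rw [← sub_eq_zero, ← sub_smul, smul_eq_zero] at h2
    -- the scalar `1 / √(Im z₁) - 1 / √(Im z₂)` does not vanish
    have h4 : P.Γ g = 0 := h2.resolve_left fun h5 => hne <| by
      rw [sub_eq_zero, neg_inj, one_div, one_div, inv_inj, Complex.ofReal_inj,
        Real.sqrt_inj hz₂.le hz₁.le] at h5
      exact h5.symm
    have h6 : g = 0 := Subtype.ext (h _ (P.mem_hermDomain_iff.2 ⟨g.2, h4⟩))
    rw [h6, map_zero]

/-- For a singular form the Hermitian domain is `dom T ∩ dom T*`. If `f ∈ dom T ∩ dom T*`, then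
`⟪g, T f - T* f⟫ = 2i ⟪Γ g, Γ f⟫` for `g ∈ dom T`; a sequence `g = f - u n → 0` with
`Γ (u n) → 0` gives `Γ f = 0`. -/
theorem mem_domain_inf_adjoint_domain_iff [CompleteSpace H] (P : BoundaryPair T E)
    (hT : T.IsDSing) {f : H} :
    f ∈ T.domain ⊓ T.adjoint.domain ↔ f ∈ T.hermDomain := by
  rw [P.mem_hermDomain_iff, Submodule.mem_inf]
  constructor
  · rintro ⟨hf, hf'⟩
    refine ⟨hf, ?_⟩
    obtain ⟨k, hk⟩ := LinearPMap.mem_domain_iff.1 hf'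
    rw [LinearPMap.mem_graph_adjoint_iff hT.1.dense] at hk
    have h1 : ∀ g : T.domain, inner ℂ (g : H) (T ⟨f, hf⟩ - k) =
        2 * Complex.I * inner ℂ (P.Γ g) (P.Γ ⟨f, hf⟩) := fun g => by
      rw [← P.green, inner_sub_right]
      linear_combination hk g
    obtain ⟨u, hu, hu0⟩ := hT.2 ⟨f, hf⟩
    have hΓ : Filter.Tendsto (fun n => P.Γ (u n)) Filter.atTop (𝓝 0) := P.tendsto_Γ_zero hu0
    have h2 : Filter.Tendsto (fun n => inner ℂ (f - (u n : H)) (T ⟨f, hf⟩ - k)) Filter.atTop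
        (𝓝 (inner ℂ (f - f) (T ⟨f, hf⟩ - k))) := (hu.const_sub f).inner tendsto_const_nhds
    have h3 : Filter.Tendsto (fun n => 2 * Complex.I *
        inner ℂ (P.Γ ⟨f, hf⟩ - P.Γ (u n)) (P.Γ ⟨f, hf⟩)) Filter.atTop
        (𝓝 (2 * Complex.I * inner ℂ (P.Γ ⟨f, hf⟩ - 0) (P.Γ ⟨f, hf⟩))) :=
      ((hΓ.const_sub _).inner tendsto_const_nhds).const_mul _
    have h4 := tendsto_nhds_unique h2 (h3.congr fun n => by
      rw [← map_sub, ← h1]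
      rfl)
    rw [sub_self, inner_zero_left, sub_zero] at h4
    simpa using h4.symm
  · rintro ⟨hf, h0⟩
    refine ⟨hf, LinearPMap.mem_domain_iff.2 ⟨T ⟨f, hf⟩, ?_⟩⟩
    rw [LinearPMap.mem_graph_adjoint_iff hT.1.dense]
    intro g
    have h1 := P.green ⟨f, hf⟩ g
    rw [h0, inner_zero_right, mul_zero] at h1
    linear_combination -h1

/-- Under `f ↦ (T - conj z) f` the graph of `T_z` corresponds to `H`, and the part of the graph
over `dom T_z²` to the Hermitian domain of `T`. -/
theorem hasCore_sqDomain_symOp_iff [CompleteSpace H] (hT : T.IsMaxDissipative) {z : ℂ}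
    (hz : 0 < z.im) : Dense T.hermDomain ↔ (P.symOp z).HasCore (P.symOp z).sqDomain := by
  obtain ⟨R, hR1, hR2⟩ := HPlus.exists_resolvent hT (μ := conj z) (by simpa using hz)
  set A := P.symOp z with hA
  let B := A.domRestrict A.sqDomain
  have hAc : A.IsClosed := P.isClosed_symOp hT hz
  have hBA : B ≤ A := LinearPMap.domRestrict_le
  have hBc : B.IsClosable := hAc.isClosable.leIsClosable hBA
  have hle : A.sqDomain ≤ A.domain := by
    rintro _ ⟨u, -, rfl⟩
    exact u.2
  have hB : ∀ p, p ∈ B.graph ↔ p.1 ∈ A.sqDomain ∧ p ∈ A.graph := fun p => by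
    constructor
    · intro h
      refine ⟨?_, LinearPMap.le_graph_of_le hBA h⟩
      obtain ⟨u, hu, -⟩ := (LinearPMap.mem_graph_iff _).1 h
      exact hu ▸ u.2.1
    · rintro ⟨h1, h2⟩
      obtain ⟨u, hu, hu'⟩ := (LinearPMap.mem_graph_iff _).1 h2
      rw [← hu] at h1
      exact (LinearPMap.mem_graph_iff _).2 ⟨⟨u, h1, u.2⟩, hu,
        (LinearPMap.domRestrict_apply rfl).trans hu'⟩
  -- the parametrization of the graph of `T_z` by `h = (T - conj z) f ∈ H`
  let G : H → WithLp 2 (H × E) × WithLp 2 (H × E) := fun h =>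
    (P.graphEmb z (HPlus.toDomain T (R h)), P.graphVal z (HPlus.toDomain T (R h)))
  have hG : Continuous G := by
    have hhsum : Continuous fun p : H × E => hsum p.1 p.2 := WithLp.prod_continuous_toLp 2 H E
    refine Continuous.prodMk ?_ ?_
    · exact hhsum.comp (((HPlus.incl T).continuous.comp R.continuous).prodMk
        ((P.gammaPlus.continuous.comp R.continuous).const_smul _))
    · exact hhsum.comp (((HPlus.opPlus T).continuous.comp R.continuous).prodMk
        ((P.gammaPlus.continuous.comp R.continuous).const_smul _))
  have hRG : ∀ f : T.domain,
      HPlus.toDomain T (R (T f - conj z • (f : H))) = f := fun f =>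
    congrArg (HPlus.toDomain T) (hR2 ((HPlus.toDomain T).symm f))
  have hRT : ∀ h, T (HPlus.toDomain T (R h)) - conj z • (HPlus.toDomain T (R h) : H) = h := hR1
  constructor
  · refine fun hd => ⟨hle, LinearPMap.eq_of_eq_graph ?_⟩
    change B.closure.graph = A.graph
    rw [← hBc.graph_closure_eq_closure_graph]
    refine le_antisymm (Submodule.topologicalClosure_minimal _
      (LinearPMap.le_graph_of_le hBA) hAc) ?_
    rintro ⟨x, y⟩ hp
    obtain ⟨f, rfl, rfl⟩ := P.mem_graph_symOp_iff.1 hp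
    have h1 : G (T f - conj z • (f : H)) = (P.graphEmb z f, P.graphVal z f) := by
      simp only [G, hRG]
    rw [← h1]
    refine map_mem_closure hG (hd _) fun h hh => (hB _).2 ⟨?_, ?_⟩
    · exact (P.mem_sqDomain_symOp_iff hz).2 ⟨_, rfl, by rwa [hRT]⟩
    · exact P.mem_graph_symOp_iff.2 ⟨_, rfl, rfl⟩
  · rintro ⟨-, hcl⟩ h
    have h1 : G h ∈ A.graph := P.mem_graph_symOp_iff.2 ⟨_, rfl, rfl⟩
    have h2 : G h ∈ _root_.closure (B.graph : Set _) := by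
      rw [← hcl, ← hBc.graph_closure_eq_closure_graph] at h1
      exact h1
    have hc : Continuous fun p : WithLp 2 (H × E) × WithLp 2 (H × E) =>
        p.2.fst - conj z • p.1.fst :=
      ((WithLp.prod_continuous_ofLp 2 H E).fst.comp continuous_snd).sub
        (((WithLp.prod_continuous_ofLp 2 H E).fst.comp continuous_fst).const_smul _)
    have h3 := map_mem_closure (t := T.hermDomain) hc h2 fun p hp => by
      obtain ⟨hp1, hp2⟩ := (hB p).1 hp
      obtain ⟨f, hf1, hf⟩ := (P.mem_sqDomain_symOp_iff hz).1 hp1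
      obtain ⟨g, hg1, hg2⟩ := P.mem_graph_symOp_iff.1 hp2
      have h4 : f = g := P.graphEmb_injective z (hf1.symm.trans hg1)
      subst h4
      rw [hg1, hg2]
      exact hf
    have h5 : (G h).2.fst - conj z • (G h).1.fst = h := hRT h
    simp only [h5] at h3
    exact h3

end BoundaryPair

theorem theorem7p2 {H E : Type*}
    [NormedAddCommGroup H] [InnerProductSpace ℂ H] [CompleteSpace H]
    [NormedAddCommGroup E] [InnerProductSpace ℂ E] [CompleteSpace E]
    (T : H →ₗ.[ℂ] H) (hT : T.IsMaxDissipative) (P : BoundaryPair T E) :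
    -- symmetry, closedness, deficiency subspaces
    (∀ z : ℂ, 0 < z.im →
      (P.symOp z).IsSymm ∧ (P.symOp z).IsClosed ∧
      (∀ μ : ℂ, ((P.symOp z).deficiencySpace μ : Set (WithLp 2 (H × E))) =
        {x | ∃ (h : H) (y : E), x = hsum h y ∧
          opCrossSub T μ h = ((z - μ) / (Real.sqrt z.im : ℂ)) • P.gammaCross y}) ∧
      ((P.symOp z).deficiencySpace z : Set (WithLp 2 (H × E))) =
        {x | ∃ y : E, x = hsum 0 y}) ∧
    -- Hermitian domain and Hermitian part of the lifting
    (∀ z : ℂ, 0 < z.im →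
      (P.lift z).IsMaxDissipative ∧ (P.symOp z).IsHermitianPart (P.lift z)) ∧
    -- congruences
    (∀ z₁ z₂ : ℂ, 0 < z₁.im → 0 < z₂.im →
      P.symOp z₂ =
        (blockDiag H E 1 (Real.sqrt (z₂.im / z₁.im) : ℂ)).compPMap
          ((blockDiag H E 0 (((conj z₂ * z₁).im / z₂.im : ℝ) : ℂ) +ᵥ P.symOp z₁).compEverywhere
            (blockDiag H E 1 (Real.sqrt (z₂.im / z₁.im) : ℂ)))) ∧
    -- density of the domain and the adjoint
    (∀ z : ℂ, 0 < z.im →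
      (Dense ((P.symOp z).domain : Set (WithLp 2 (H × E))) ↔ T.IsDSing)) ∧
    (∀ z : ℂ, 0 < z.im → (opCrossSub T z).IsInvertible) ∧
    (T.IsDSing →
      (∀ z : ℂ, 0 < z.im →
        (∀ x ∈ (P.symOp z).adjoint.domain, ∃ (f : T.adjoint.domain) (y w : E),
          x = hsum ((f : H) +
            (2 * Complex.I * (Real.sqrt z.im : ℂ)) • P.crossResolventGamma z y) (y + w)) ∧
        (∀ (f : T.adjoint.domain) (y w : E),
          ∃ hx : hsum ((f : H) +
              (2 * Complex.I * (Real.sqrt z.im : ℂ)) • P.crossResolventGamma z y) (y + w) ∈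
              (P.symOp z).adjoint.domain,
            (P.symOp z).adjoint ⟨_, hx⟩ =
              hsum (T.adjoint f +
                (2 * Complex.I * z * (Real.sqrt z.im : ℂ)) • P.crossResolventGamma z y)
                (conj z • y + z • w))) ∧
      (∀ z₁ z₂ : ℂ, 0 < z₁.im → 0 < z₂.im →
        (P.symOp z₁).adjoint.domain = (P.symOp z₂).adjoint.domain)) ∧
    -- simplicity
    (∀ z : ℂ, 0 < z.im → ((P.symOp z).IsSimple ↔ T.IsSimple)) ∧
    -- the square
    (T.IsDSing → ∀ z : ℂ, 0 < z.im →
      List.TFAE [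
        (P.symOp z).sqDomain = ⊥,
        ∃ z₁ z₂ : ℂ, 0 < z₁.im ∧ 0 < z₂.im ∧ z₁.im ≠ z₂.im ∧
          (P.symOp z₁).domain ⊓ (P.symOp z₂).domain = ⊥,
        ∀ z₁ z₂ : ℂ, 0 < z₁.im → 0 < z₂.im → z₁.im ≠ z₂.im →
          (P.symOp z₁).domain ⊓ (P.symOp z₂).domain = ⊥,
        T.domain ⊓ T.adjoint.domain = ⊥] ∧
      (Dense T.hermDomain ↔ (P.symOp z).HasCore (P.symOp z).sqDomain)) := by
  refine ⟨fun z hz => ⟨P.isSymm_symOp hz, P.isClosed_symOp hT hz, P.deficiencySpace_symOp z,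
      P.deficiencySpace_symOp_self hT hz⟩,
    fun z hz => ⟨P.isMaxDissipative_lift hT hz, P.isHermitianPart_symOp hz⟩,
    fun z₁ z₂ hz₁ hz₂ => P.symOp_eq_congruence hz₁ hz₂,
    fun z hz => P.dense_domain_symOp_iff hT hz,
    fun z hz => isInvertible_opCrossSub hT hz,
    fun hS => ⟨fun z hz => ⟨fun x hx => P.exists_eq_of_mem_domain_adjoint_symOp hS hz hx,
      P.exists_adjoint_symOp_apply hS hz⟩, fun z₁ z₂ => P.domain_adjoint_symOp_eq hS⟩,
    fun z hz => ⟨P.isSimple_of_isSimple_symOp hz, P.isSimple_symOp_of_isSimple hz⟩,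
    fun hS z hz => ⟨?_, P.hasCore_sqDomain_symOp_iff hT hz⟩⟩
  have h4 : T.domain ⊓ T.adjoint.domain = ⊥ ↔ ∀ f ∈ T.hermDomain, f = 0 := by
    rw [Submodule.eq_bot_iff]
    exact forall_congr' fun f => by rw [P.mem_domain_inf_adjoint_domain_iff hS]
  tfae_have 1 ↔ 4 := (P.sqDomain_symOp_eq_bot_iff hT hz).trans h4.symm
  tfae_have 4 → 3 := fun h z₁ z₂ hz₁ hz₂ hne =>
    (P.domain_symOp_inf_eq_bot_iff hz₁ hz₂ hne).2 (h4.1 h)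
  tfae_have 3 → 2 := fun h => ⟨Complex.I, 2 * Complex.I, by simp, by simp, by simp,
    h _ _ (by simp) (by simp) (by simp)⟩
  tfae_have 2 → 4 := fun ⟨_, _, hz₁, hz₂, hne, h⟩ =>
    h4.2 ((P.domain_symOp_inf_eq_bot_iff hz₁ hz₂ hne).1 h)
  tfae_finish
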